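/- Let $E$ be an infinite-dimensional real Banach space. Suppose that $E$ admits an equivalent norm $N$ that is strictly convex and of class $C^1$ on $E\setminus\{0\}$, and that $E$ has a Schauder basis $\{e_n\}_{n\in\mathbb{N}}$ which is $1$-suppression unconditional for $N$, that is, for every $x=\sum_{j}x_je_j\in E$ and every $j_0\in\mathbb{N}$, $$N\Big(\sum_{j\neq j_0}x_je_j\Big)\le N\Big(\sum_{j}x_je_j\Big).$$ Let $U\subseteq E$ be open, let $d$ be a natural number, and give $\mathbb{R}^d$ the Euclidean norm. Let $f:U\to\mathbb{R}^d$ be a $C^1$ map and $\varepsilon:U\to(0,\infty)$ a continuous function. Then there exists a $C^1$ map $g:U\to\mathbb{R}^d$ such that 1. $\|f(x)-g(x)\|\le\varepsilon(x)$ for every $x\in U$; 2. $\|Df(x)-Dg(x)\|\le\varepsilon(x)$ for every $x\in U$ (operator norm); 3. the critical set $C_g=\{x\in U: Dg(x):E\to\mathbb{R}^d\text{ is not surjective}\}$ is locally contained in a finite union of complemented subspaces of infinite codimension in $E$: for every $x\in C_g$ there are an open neighbourhood $V$ of $x$ and finitely many closed subspaces $E_1,\dots,E_n$ of $E$, each complemented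 in $E$ and of infinite codimension, with $C_g\cap V\subseteq\bigcup_{j=1}^{n}E_j$. -/

import Mathlib

/-- `N` is a norm on `E` that is equivalent to the given norm of `E`. -/
def IsEquivalentNorm {E : Type*} [NormedAddCommGroup E] [NormedSpace ℝ E]
    (N : Seminorm ℝ E) : Prop :=
  ∃ c C : ℝ, 0 < c ∧ 0 < C ∧ ∀ x : E, c * ‖x‖ ≤ N x ∧ N x ≤ C * ‖x‖

/-- The norm `N` is of class `C¹` (away from the origin, where no norm is differentiable). -/
def IsC1Norm {E : Type*} [NormedAddCommGroup E] [NormedSpace ℝ E]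
    (N : Seminorm ℝ E) : Prop :=
  ContDiffOn ℝ 1 (fun x : E => N x) {x : E | x ≠ 0}

/-- The norm `N` is strictly convex: the midpoint of two distinct unit vectors has norm `< 1`. -/
def IsStrictlyConvexNorm {E : Type*} [NormedAddCommGroup E] [NormedSpace ℝ E]
    (N : Seminorm ℝ E) : Prop :=
  ∀ x y : E, N x = 1 → N y = 1 → x ≠ y → N ((1 / 2 : ℝ) • (x + y)) < 1

/-- The Schauder basis `b` is `1`-suppression unconditional for the norm `N`: deleting one term
from the expansion of a vector does not increase its norm. -/
def IsOneSuppressionUnconditional {E : Type*} [NormedAddCommGroup E] [NormedSpace ℝ E]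
    (N : Seminorm ℝ E) (b : SchauderBasis ℝ E) : Prop :=
  ∀ (x : E) (j : ℕ), N (x - b.coord j x • b j) ≤ N x

/-- The critical set of `g` in the open set `U`. -/
def criticalSet {E F : Type*} [NormedAddCommGroup E] [NormedSpace ℝ E]
    [NormedAddCommGroup F] [NormedSpace ℝ F] (g : E → F) (U : Set E) : Set E :=
  {x : E | x ∈ U ∧ ¬ Function.Surjective (fderiv ℝ g x)}

/-- `X` is locally contained in a finite union of complemented subspaces of infinite codimension:
every point of `X` has an open neighbourhood `V` such that `X ∩ V` is contained in a finite union
of closed subspaces of `E` that are complemented in `E` and have infinite codimension. -/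
def LocallyInFiniteUnionOfComplemented {E : Type*} [NormedAddCommGroup E] [NormedSpace ℝ E]
    (X : Set E) : Prop :=
  ∀ x ∈ X, ∃ V : Set E, IsOpen V ∧ x ∈ V ∧
    ∃ (n : ℕ) (S : Fin n → Submodule ℝ E),
      (∀ i, IsClosed (S i : Set E) ∧ (S i).ClosedComplemented ∧
        ¬ FiniteDimensional ℝ (E ⧸ S i)) ∧
      X ∩ V ⊆ ⋃ i, (S i : Set E)

open Filter Topology Set

/-! ### Coordinates, partial sums and tails of a Schauder basis -/

section Coordinates

variable {E : Type*} [NormedAddCommGroup E] [NormedSpace ℝ E]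

/-! Where f is nearly affine, replace x by a partial sum of its expansion, so that f sees only
finitely many coordinates, and feed the remaining coordinates to an explicit small perturbation
whose critical points can be computed.

The truncation must be C¹. A countable cover of U by N-balls on which f and Df vary little yields
radius functions τ_k. Let T_k(x) be `tailSize`, a C¹ substitute for the norm of the k-th tail,
S_k(x) the `frozenSum`, and ρ_k = τ_k(S_k)/T_k the `radiusRatio`. The k-th term is kept in full
while ρ_k ≤ 1 and dropped once ρ_k ≥ 2. From then on S is constant in k while τ_k grows and T_k
tends to 0, so ρ_k increases, and it passes every bound. Near any point of U one index K with ρ_K >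
10 therefore suffices, and g = f ∘ S_K + G_K does not depend on the choice of K. Here G_K is the
series of small multiples x_j w_j, each gated by ρ_j for j < K, and w runs periodically through the
standard basis of ℝ^d and 0.

Closeness of derivatives has two ingredients. DS_K is bounded uniformly, because τ has a small
Lipschitz constant (`IsFirstDominated.fderiv_frozenSum_le`). Moreover DS_K v - v lies in a far tail,
where Df is small because the basis is shrinking; this follows from the C¹ norm by Ekeland's
principle.

At a critical point some φ ≠ 0 annihilates Dg. Let m be the first index with ρ_m ≥ 2. On the first m
basis vectors the gates are shut and the tails in the moving gates do not change, while DS_m is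
invertible on their span; hence everything factoring through DS_m drops out. The windows of the
gates are arranged so that at most one gate, say l, moves. What remains is that, for j ≥ K, the
weight of j times φ(w_j) is a fixed multiple of DT_l(b_j). Some φ(w_i) is nonzero, so that multiple
is nonzero. Where w_j = 0 this forces DT_l(b_j) = 0, and strict convexity with suppression
unconditionality then gives x_j = 0. Thus infinitely many prescribed coordinates vanish, and
unconditionality complements the subspace so defined. -/

theorem SchauderBasis.coord_self (b : SchauderBasis ℝ E) (j : ℕ) : b.coord j (b j) = 1 := by
  simp [b.ortho]

theorem SchauderBasis.coord_of_ne (b : SchauderBasis ℝ E) {i j : ℕ} (h : i ≠ j) :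
    b.coord i (b j) = 0 := by
  simp [b.ortho, h]

theorem SchauderBasis.coord_proj (b : SchauderBasis ℝ E) (j k : ℕ) (x : E) :
    b.coord j (b.proj k x) = if j < k then b.coord j x else 0 := by
  simp [SchauderBasis.proj_apply, map_sum, b.ortho, Pi.single_apply]

theorem SchauderBasis.coord_sum (b : SchauderBasis ℝ E) (s : Finset ℕ) (a : ℕ → ℝ) (j : ℕ) :
    b.coord j (∑ l ∈ s, a l • b l) = if j ∈ s then a j else 0 := by
  simp [map_sum, b.ortho, Pi.single_apply]

/-- The projection onto the closed span of the basis vectors of index at least `k`. -/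
noncomputable def SchauderBasis.tail (b : SchauderBasis ℝ E) (k : ℕ) : E →L[ℝ] E :=
  ContinuousLinearMap.id ℝ E - b.proj k

theorem SchauderBasis.tail_apply (b : SchauderBasis ℝ E) (k : ℕ) (x : E) :
    b.tail k x = x - b.proj k x := rfl

theorem SchauderBasis.coord_tail (b : SchauderBasis ℝ E) (j k : ℕ) (x : E) :
    b.coord j (b.tail k x) = if k ≤ j then b.coord j x else 0 := by
  rw [b.tail_apply, map_sub, b.coord_proj]
  by_cases h : j < k
  · simp [h, not_le.2 h]
  · simp [h, not_lt.1 h]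

theorem SchauderBasis.tail_basis_of_lt (b : SchauderBasis ℝ E) {j k : ℕ} (h : j < k) :
    b.tail k (b j) = 0 := by
  simp only [b.tail_apply, SchauderBasis.proj_apply_basis_mem]
  simp [h]

theorem SchauderBasis.tail_basis_of_le (b : SchauderBasis ℝ E) {j k : ℕ} (h : k ≤ j) :
    b.tail k (b j) = b j := by
  simp only [b.tail_apply, SchauderBasis.proj_apply_basis_mem]
  simp [not_lt.2 h]

theorem SchauderBasis.tail_tail (b : SchauderBasis ℝ E) {k l : ℕ} (h : k ≤ l) (x : E) :
    b.tail l (b.tail k x) = b.tail l x := by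
  simp only [b.tail_apply, map_sub, SchauderBasis.proj_comp, min_eq_right h]
  abel

theorem SchauderBasis.tendsto_tail (b : SchauderBasis ℝ E) (x : E) :
    Tendsto (fun k => b.tail k x) atTop (𝓝 0) := by
  have h := (SchauderBasis.tendsto_proj b x).const_sub x
  simpa [b.tail_apply] using h

end Coordinates

/-! ### Multiplier estimates from suppression unconditionality -/

section Suppression

variable {E : Type*} [NormedAddCommGroup E] [NormedSpace ℝ E] {N : Seminorm ℝ E}
  {b : SchauderBasis ℝ E}

theorem IsEquivalentNorm.continuous (hN : IsEquivalentNorm N) : Continuous (fun x => N x) := by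
  obtain ⟨c, C, hc, hC, h⟩ := hN
  refine Seminorm.continuous_of_le (q := C.toNNReal • normSeminorm ℝ E) ?_ ?_
  · have : Continuous fun x : E => C.toNNReal • ‖x‖ := by fun_prop
    exact this
  · intro x
    have := (h x).2
    simpa [NNReal.smul_def, hC.le] using this

theorem IsEquivalentNorm.pos (hN : IsEquivalentNorm N) {x : E} (hx : x ≠ 0) : 0 < N x := by
  obtain ⟨c, C, hc, hC, h⟩ := hN
  exact lt_of_lt_of_le (mul_pos hc (norm_pos_iff.2 hx)) (h x).1

/-- Shrinking one coordinate is a convex combination of keeping it and deleting it. -/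
theorem IsOneSuppressionUnconditional.sub_smul_le (hb : IsOneSuppressionUnconditional N b) (x : E)
    (j : ℕ) {a : ℝ} (h0 : 0 ≤ a) (h1 : a ≤ 1) : N (x - (a * b.coord j x) • b j) ≤ N x := by
  have e : x - (a * b.coord j x) • b j = (1 - a) • x + a • (x - b.coord j x • b j) := by
    module
  calc N (x - (a * b.coord j x) • b j) ≤ (1 - a) * N x + a * N (x - b.coord j x • b j) := by
        rw [e]
        refine (map_add_le_add N _ _).trans ?_
        rw [map_smul_eq_mul, map_smul_eq_mul, Real.norm_of_nonneg h0,
          Real.norm_of_nonneg (by linarith)]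
    _ ≤ (1 - a) * N x + a * N x := by gcongr; exact hb x j
    _ = N x := by ring

theorem IsOneSuppressionUnconditional.sub_sum_le (hb : IsOneSuppressionUnconditional N b)
    (s : Finset ℕ) (a : ℕ → ℝ) (h0 : ∀ l ∈ s, 0 ≤ a l) (h1 : ∀ l ∈ s, a l ≤ 1) (x : E) :
    N (x - ∑ l ∈ s, (a l * b.coord l x) • b l) ≤ N x := by
  classical
  induction s using Finset.induction_on with
  | empty => simp
  | insert j s hj ih =>
    set z := x - ∑ l ∈ s, (a l * b.coord l x) • b l with hz
    have hc : b.coord j z = b.coord j x := by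
      rw [hz, map_sub, b.coord_sum]; simp [hj]
    have e : x - ∑ l ∈ insert j s, (a l * b.coord l x) • b l = z - (a j * b.coord j z) • b j := by
      rw [Finset.sum_insert hj, hc, hz]; abel
    rw [e]
    refine (hb.sub_smul_le z j (h0 j (by simp)) (h1 j (by simp))).trans ?_
    exact ih (fun l hl => h0 l (by simp [hl])) (fun l hl => h1 l (by simp [hl]))

theorem IsOneSuppressionUnconditional.tail_le (hb : IsOneSuppressionUnconditional N b)
    (k : ℕ) (x : E) : N (b.tail k x) ≤ N x := by
  simpa [b.tail_apply] using hb.sub_sum_le (Finset.range k) (fun _ => 1) (by simp) (by simp) x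

theorem IsOneSuppressionUnconditional.tail_anti (hb : IsOneSuppressionUnconditional N b)
    {k l : ℕ} (h : k ≤ l) (x : E) : N (b.tail l x) ≤ N (b.tail k x) := by
  rw [← b.tail_tail h]
  exact hb.tail_le l _

/-- A partial sum is a limit of vectors obtained from x by deleting a finite block of coordinates.
-/
theorem IsOneSuppressionUnconditional.proj_le (hb : IsOneSuppressionUnconditional N b)
    (hN : IsEquivalentNorm N) (k : ℕ) (x : E) : N (b.proj k x) ≤ N x := by
  have h1 : Tendsto (fun n => N (b.proj k x + b.tail n x)) atTop (𝓝 (N (b.proj k x))) := by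
    have := (b.tendsto_tail x).const_add (b.proj k x)
    rw [add_zero] at this
    exact (hN.continuous.tendsto _).comp this
  refine le_of_tendsto h1 (eventually_atTop.2 ⟨k, fun n hn => ?_⟩)
  have e : b.proj k x + b.tail n x
      = x - ∑ l ∈ Finset.range n \ Finset.range k, ((1 : ℝ) * b.coord l x) • b l := by
    have := Finset.sum_sdiff (f := fun l => b.coord l x • b l) (Finset.range_subset_range.2 hn)
    simp only [b.tail_apply, SchauderBasis.proj_apply, one_mul, ← this]
    abel
  rw [e]
  exact hb.sub_sum_le _ (fun _ => 1) (by simp) (by simp) x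

/-- Inside a long enough partial sum, multiplying by a on s amounts to removing the fraction 1 - a
on s and everything off s. -/
theorem IsOneSuppressionUnconditional.sum_le (hb : IsOneSuppressionUnconditional N b)
    (hN : IsEquivalentNorm N) (s : Finset ℕ) (a : ℕ → ℝ) (h0 : ∀ l ∈ s, 0 ≤ a l)
    (h1 : ∀ l ∈ s, a l ≤ 1) (x : E) : N (∑ l ∈ s, (a l * b.coord l x) • b l) ≤ N x := by
  classical
  obtain ⟨n, hn⟩ : ∃ n, s ⊆ Finset.range n := s.exists_nat_subset_range
  have e : ∑ l ∈ s, (a l * b.coord l x) • b l = b.proj n x -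
      ∑ l ∈ Finset.range n, ((if l ∈ s then 1 - a l else 1) * b.coord l (b.proj n x)) • b l := by
    rw [SchauderBasis.proj_apply, ← Finset.sum_sub_distrib, ← Finset.sum_subset hn]
    · refine Finset.sum_congr rfl fun l hl => ?_
      rw [← SchauderBasis.proj_apply, b.coord_proj, if_pos hl,
        if_pos (Finset.mem_range.1 (hn hl))]
      module
    · intro l hl hls
      rw [← SchauderBasis.proj_apply, b.coord_proj, if_neg hls, if_pos (Finset.mem_range.1 hl)]
      module
  rw [e]
  refine (hb.sub_sum_le _ _ ?_ ?_ _).trans (hb.proj_le hN n x)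
  · intro l _
    split_ifs with h
    · linarith [h1 l h]
    · norm_num
  · intro l _
    split_ifs with h
    · linarith [h0 l h]
    · norm_num

theorem IsOneSuppressionUnconditional.sum_tail_le (hb : IsOneSuppressionUnconditional N b)
    (hN : IsEquivalentNorm N) (s : Finset ℕ) (a : ℕ → ℝ) {k : ℕ} (hs : ∀ l ∈ s, k ≤ l)
    (h0 : ∀ l ∈ s, 0 ≤ a l) (h1 : ∀ l ∈ s, a l ≤ 1) (x : E) :
    N (∑ l ∈ s, (a l * b.coord l x) • b l) ≤ N (b.tail k x) := by
  have e : ∑ l ∈ s, (a l * b.coord l x) • b l = ∑ l ∈ s, (a l * b.coord l (b.tail k x)) • b l :=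
    Finset.sum_congr rfl fun l hl => by rw [b.coord_tail, if_pos (hs l hl)]
  rw [e]
  exact hb.sum_le hN s a h0 h1 _

/-- Signed multipliers split into positive and negative parts, whence the factor 2. -/
theorem IsOneSuppressionUnconditional.sum_tail_le_of_abs_le
    (hb : IsOneSuppressionUnconditional N b) (hN : IsEquivalentNorm N) (s : Finset ℕ) (a : ℕ → ℝ)
    {k : ℕ} (hs : ∀ l ∈ s, k ≤ l) {M : ℝ} (hM : 0 ≤ M) (h : ∀ l ∈ s, |a l| ≤ M) (x : E) :
    N (∑ l ∈ s, (a l * b.coord l x) • b l) ≤ 2 * M * N (b.tail k x) := by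
  rcases hM.eq_or_lt with rfl | hM
  · have : ∑ l ∈ s, (a l * b.coord l x) • b l = 0 :=
      Finset.sum_eq_zero fun l hl => by simp [abs_nonpos_iff.1 (h l hl)]
    simp [this]
  have e : ∑ l ∈ s, (a l * b.coord l x) • b l
      = M • ∑ l ∈ s, ((max (a l) 0 / M) * b.coord l x) • b l
        - M • ∑ l ∈ s, ((max (-a l) 0 / M) * b.coord l x) • b l := by
    rw [Finset.smul_sum, Finset.smul_sum, ← Finset.sum_sub_distrib]
    refine Finset.sum_congr rfl fun l _ => ?_
    rw [smul_smul, smul_smul, ← sub_smul]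
    congr 1
    have : a l = max (a l) 0 - max (-a l) 0 := by
      rcases le_total (a l) 0 with h | h
      · rw [max_eq_right h, max_eq_left (by linarith)]; ring
      · rw [max_eq_left h, max_eq_right (by linarith)]; ring
    field_simp
    linear_combination (b.coord l x) * this
  have key : ∀ u : ℕ → ℝ, (∀ l ∈ s, 0 ≤ u l) → (∀ l ∈ s, u l ≤ M) →
      N (M • ∑ l ∈ s, ((u l / M) * b.coord l x) • b l) ≤ M * N (b.tail k x) := by
    intro u hu0 hu1
    rw [map_smul_eq_mul, Real.norm_of_nonneg hM.le]
    gcongr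
    exact hb.sum_tail_le hN s _ hs (fun l hl => div_nonneg (hu0 l hl) hM.le)
      (fun l hl => (div_le_one hM).2 (hu1 l hl)) x
  rw [e]
  refine (map_sub_le_add N _ _).trans ?_
  have h1 := key (fun l => max (a l) 0) (fun l _ => le_max_right _ _)
    (fun l hl => max_le ((le_abs_self _).trans (h l hl)) hM.le)
  have h2 := key (fun l => max (-a l) 0) (fun l _ => le_max_right _ _)
    (fun l hl => max_le ((neg_le_abs _).trans (h l hl)) hM.le)
  linarith

theorem IsOneSuppressionUnconditional.coord_smul_le (hb : IsOneSuppressionUnconditional N b)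
    (hN : IsEquivalentNorm N) {j k : ℕ} (h : k ≤ j) (x : E) :
    |b.coord j x| * N (b j) ≤ N (b.tail k x) := by
  have := hb.sum_tail_le hN {j} (fun _ => 1) (k := k) (by simpa using h) (by simp) (by simp) x
  simpa [map_smul_eq_mul] using this

end Suppression

/-! ### Ekeland's principle and one-sided derivative bounds -/

section Variational

/-- Ekeland's variational principle, in its weak form. -/
theorem exists_forall_le_add_mul_dist {X : Type*} [MetricSpace X] [CompleteSpace X] [Nonempty X]
    {J : X → ℝ} (hJ : Continuous J) (hbdd : BddBelow (range J)) {δ : ℝ} (hδ : 0 < δ) :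
    ∃ x, ∀ y, J x ≤ J y + δ * dist x y := by
  -- Among the points lying below x by at least δ times their distance to x, choose z at least
  -- halfway down towards their infimum.
  have step : ∀ x, ∃ z, J z + δ * dist x z ≤ J x ∧
      ∀ y, J y + δ * dist x y ≤ J x → 2 * J z ≤ J x + J y := by
    intro x
    by_cases h : ∀ y, J y + δ * dist x y ≤ J x → 2 * J x ≤ J x + J y
    · exact ⟨x, by simp, h⟩
    · push Not at h
      obtain ⟨y₀, hy₀, hlt⟩ := h
      set A := J '' {y | J y + δ * dist x y ≤ J x}
      have hA : BddBelow A := hbdd.mono (image_subset_range _ _)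
      have hne : A.Nonempty := ⟨J y₀, y₀, hy₀, rfl⟩
      have hlt' : sInf A < (J x + sInf A) / 2 := by
        have : sInf A ≤ J y₀ := csInf_le hA ⟨y₀, hy₀, rfl⟩
        linarith
      obtain ⟨_, ⟨z, hz, rfl⟩, hz'⟩ := exists_lt_of_csInf_lt hne hlt'
      refine ⟨z, hz, fun y hy => ?_⟩
      have : sInf A ≤ J y := csInf_le hA ⟨y, hy, rfl⟩
      linarith
  choose F hF1 hF2 using step
  obtain ⟨x₀⟩ := ‹Nonempty X›
  set u : ℕ → X := fun n => F^[n] x₀ with hu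
  have hsucc : ∀ n, u (n + 1) = F (u n) := fun n => Function.iterate_succ_apply' F n x₀
  have hdist : ∀ n m, n ≤ m → J (u m) + δ * dist (u n) (u m) ≤ J (u n) := by
    intro n m h
    induction m, h using Nat.le_induction with
    | base => simp
    | succ m hm ih =>
      have h1 := hF1 (u m)
      rw [← hsucc] at h1
      have h2 := mul_le_mul_of_nonneg_left (dist_triangle (u n) (u m) (u (m + 1))) hδ.le
      linarith
  have hanti : Antitone (fun n => J (u n)) := antitone_nat_of_succ_le fun n => by
    have := hdist n (n + 1) n.le_succ
    have h2 := mul_nonneg hδ.le (dist_nonneg (x := u n) (y := u (n + 1)))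
    linarith
  have hb : BddBelow (range fun n => J (u n)) :=
    hbdd.mono (range_subset_iff.2 fun n => mem_range_self _)
  set l := ⨅ n, J (u n)
  have hlim : Tendsto (fun n => J (u n)) atTop (𝓝 l) := tendsto_atTop_ciInf hanti hb
  have hl : ∀ n, l ≤ J (u n) := fun n => ciInf_le hb n
  have hcauchy : CauchySeq u := by
    refine cauchySeq_of_le_tendsto_0 (fun n => 2 * (J (u n) - l) / δ) ?_ ?_
    · intro n m k hn hm
      have h1 := hdist k n hn
      have h2 := hdist k m hm
      have h3 := mul_le_mul_of_nonneg_left (dist_triangle_left (u n) (u m) (u k)) hδ.le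
      rw [le_div_iff₀ hδ]
      linarith [hl n, hl m]
    · have := ((hlim.sub_const l).const_mul 2).div_const δ
      simpa using this
  obtain ⟨x, hx⟩ := cauchySeq_tendsto_of_complete hcauchy
  have hJx : J x = l := tendsto_nhds_unique ((hJ.tendsto x).comp hx) hlim
  have hxS : ∀ n, J x + δ * dist (u n) x ≤ J (u n) := by
    intro n
    have h1 : Tendsto (fun m => J (u m) + δ * dist (u n) (u m)) atTop
        (𝓝 (J x + δ * dist (u n) x)) :=
      ((hJ.tendsto x).comp hx).add ((tendsto_const_nhds.dist hx).const_mul δ)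
    exact le_of_tendsto h1 (eventually_atTop.2 ⟨n, fun m hm => hdist n m hm⟩)
  refine ⟨x, fun y => ?_⟩
  by_contra! hlt
  -- A point y violating the claim is admissible at every stage, so the halving property passes to
  -- the limit and gives J x ≤ J y.
  have h1 : ∀ n, 2 * J (u (n + 1)) ≤ J (u n) + J y := by
    intro n
    rw [hsucc]
    refine hF2 (u n) y ?_
    have := mul_le_mul_of_nonneg_left (dist_triangle (u n) x y) hδ.le
    linarith [hxS n]
  have h2 : 2 * l ≤ l + J y :=
    le_of_tendsto_of_tendsto' ((hlim.comp (tendsto_add_atTop_nat 1)).const_mul 2)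
      (hlim.add_const (J y)) h1
  have h3 := mul_nonneg hδ.le (dist_nonneg (x := x) (y := y))
  linarith

variable {E : Type*} [NormedAddCommGroup E] [NormedSpace ℝ E]

theorem HasFDerivAt.apply_le_of_forall_pos {f : E → ℝ} {f' : E →L[ℝ] ℝ} {x v : E} {L : ℝ}
    (h : HasFDerivAt f f' x) (hL : ∀ s : ℝ, 0 < s → s ≤ 1 → f (x + s • v) - f x ≤ s * L) :
    f' v ≤ L := by
  have h1 := (h.hasLineDerivAt v).tendsto_slope_zero_right
  refine le_of_tendsto h1 ?_
  filter_upwards [Ioc_mem_nhdsGT (zero_lt_one' ℝ)] with s hs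
  rw [smul_eq_mul, inv_mul_le_iff₀ hs.1]
  exact hL s hs.1 hs.2

/-- An upper bound on increments is enough, since it applies to both v and -v. -/
theorem HasFDerivAt.abs_apply_le_seminorm {f : E → ℝ} {f' : E →L[ℝ] ℝ} {x : E} {N : Seminorm ℝ E}
    {L : ℝ} (h : HasFDerivAt f f' x) (hL : ∀ w, f (x + w) - f x ≤ L * N w) (v : E) :
    |f' v| ≤ L * N v := by
  have key : ∀ v, f' v ≤ L * N v := fun v => h.apply_le_of_forall_pos fun s hs _ => by
    refine (hL _).trans_eq ?_
    rw [map_smul_eq_mul, Real.norm_of_nonneg hs.le]; ring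
  refine abs_le.2 ⟨?_, key v⟩
  have := key (-v)
  rw [map_neg, map_neg_eq_map] at this
  linarith

end Variational

/-! ### Smoothness of the squared norm; the basis is shrinking -/

section SquaredNorm

variable {E : Type*} [NormedAddCommGroup E] [NormedSpace ℝ E] {N : Seminorm ℝ E}
  {b : SchauderBasis ℝ E}

/-- Squaring repairs the origin: the derivative of N is bounded, so that of N² is at most a multiple
of ‖x‖ and tends to 0. -/
theorem IsC1Norm.contDiff_sq (hC : IsC1Norm N) (hN : IsEquivalentNorm N) :
    ContDiff ℝ 1 (fun x => N x ^ 2) := by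
  obtain ⟨c, C, hc, hC0, h⟩ := hN
  have hopen : IsOpen {x : E | x ≠ 0} := isOpen_ne
  have hat : ∀ x : E, x ≠ 0 → ContDiffAt ℝ 1 (fun x => N x) x :=
    fun x hx => hC.contDiffAt (hopen.mem_nhds hx)
  have hzero : HasFDerivAt (fun x => N x ^ 2) (0 : E →L[ℝ] ℝ) 0 := by
    rw [hasFDerivAt_iff_isLittleO_nhds_zero]
    have h1 : (fun v : E => N v ^ 2) =O[𝓝 0] fun v : E => ‖v‖ ^ 2 := by
      refine Asymptotics.IsBigO.of_bound (C ^ 2) (Eventually.of_forall fun v => ?_)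
      rw [Real.norm_of_nonneg (by positivity), Real.norm_of_nonneg (by positivity), ← mul_pow]
      exact pow_le_pow_left₀ (apply_nonneg N v) (h v).2 2
    have h2 : (fun v : E => ‖v‖ ^ 2) =o[𝓝 0] fun v : E => v := by
      have := Asymptotics.isLittleO_norm_pow_id (E' := E) (one_lt_two)
      exact this
    simpa using h1.trans_isLittleO h2
  have hder : ∀ x : E, ‖fderiv ℝ (fun x => N x ^ 2) x‖ ≤ 2 * C ^ 2 * ‖x‖ := by
    intro x
    rcases eq_or_ne x 0 with rfl | hx
    · rw [hzero.fderiv]; simp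
    · have hd := (hat x hx).differentiableAt one_ne_zero
      have e := (hd.hasFDerivAt.pow 2).fderiv
      rw [e]
      have hl : ‖fderiv ℝ (fun x => N x) x‖ ≤ C := by
        refine ContinuousLinearMap.opNorm_le_bound _ hC0.le fun v => ?_
        have := hd.hasFDerivAt.abs_apply_le_seminorm (N := N) (L := 1) (fun w => by
          linarith [map_add_le_add N x w]) v
        rw [Real.norm_eq_abs]
        linarith [(h v).2]
      rw [norm_smul]
      have h0 : ‖(2 • N x ^ (2 - 1) : ℝ)‖ ≤ 2 * (C * ‖x‖) := by
        have : (2 • N x ^ (2 - 1) : ℝ) = 2 * N x := by norm_num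
        rw [this, Real.norm_of_nonneg (by positivity)]
        linarith [(h x).2]
      calc _ ≤ 2 * (C * ‖x‖) * C := mul_le_mul h0 hl (norm_nonneg _) (by positivity)
        _ = _ := by ring
  rw [contDiff_one_iff_fderiv]
  constructor
  · intro x
    rcases eq_or_ne x 0 with rfl | hx
    · exact hzero.differentiableAt
    · exact (((hat x hx).differentiableAt one_ne_zero).pow 2)
  · rw [continuous_iff_continuousAt]
    intro x
    rcases eq_or_ne x 0 with rfl | hx
    · rw [ContinuousAt, hzero.fderiv, tendsto_zero_iff_norm_tendsto_zero]
      have h1 : Tendsto (fun x : E => 2 * C ^ 2 * ‖x‖) (𝓝 0) (𝓝 0) := by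
        have : Continuous fun x : E => 2 * C ^ 2 * ‖x‖ := by fun_prop
        simpa using this.tendsto 0
      exact squeeze_zero (fun _ => norm_nonneg _) hder h1
    · exact ((hat x hx).pow 2).continuousAt_fderiv one_ne_zero

theorem IsOneSuppressionUnconditional.exists_norm_tail_le
    (hb : IsOneSuppressionUnconditional N b) (hN : IsEquivalentNorm N) :
    ∃ M : ℝ, 0 < M ∧ ∀ k, ‖b.tail k‖ ≤ M := by
  obtain ⟨c, C, hc, hC0, h⟩ := hN
  refine ⟨C / c, by positivity, fun k => ?_⟩
  refine ContinuousLinearMap.opNorm_le_bound _ (by positivity) fun v => ?_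
  rw [div_mul_eq_mul_div, le_div_iff₀ hc]
  linarith [(h (b.tail k v)).1, (h v).2, hb.tail_le k v]

/-- A basis that is suppression unconditional for a `C¹` norm is shrinking. -/
theorem IsOneSuppressionUnconditional.tendsto_norm_comp_tail [CompleteSpace E]
    (hb : IsOneSuppressionUnconditional N b) (hN : IsEquivalentNorm N) (hC : IsC1Norm N)
    (φ : E →L[ℝ] ℝ) : Tendsto (fun k => ‖φ.comp (b.tail k)‖) atTop (𝓝 0) := by
  obtain ⟨M, hM0, hM⟩ := hb.exists_norm_tail_le hN
  have hsq := hC.contDiff_sq hN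
  obtain ⟨hdiff, hcont⟩ := contDiff_one_iff_fderiv.1 hsq
  -- A partial sum minimises N among its translates by tail vectors, so the derivative of N² there
  -- kills the tail.
  have hzero : ∀ k x v, fderiv ℝ (fun x => N x ^ 2) (b.proj k x) (b.tail k v) = 0 := by
    intro k x v
    have hd := (hdiff (b.proj k x)).hasFDerivAt
    have key : ∀ v, 0 ≤ fderiv ℝ (fun x => N x ^ 2) (b.proj k x) (b.tail k v) := by
      intro v
      have h1 : HasFDerivAt (fun x => - N x ^ 2) (-fderiv ℝ (fun x => N x ^ 2) (b.proj k x))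
          (b.proj k x) := hd.neg
      have := h1.apply_le_of_forall_pos (v := b.tail k v) (L := 0) fun s hs _ => by
        have e : b.proj k (b.proj k x + s • b.tail k v) = b.proj k x := by
          rw [map_add, map_smul, b.tail_apply, map_sub, SchauderBasis.proj_comp,
            SchauderBasis.proj_comp]
          simp
        have h2 := hb.proj_le hN k (b.proj k x + s • b.tail k v)
        rw [e] at h2
        have := pow_le_pow_left₀ (apply_nonneg N _) h2 2
        linarith
      simpa using this
    have h2 := key (-v)
    rw [map_neg, map_neg] at h2
    linarith [key v]
  rw [Metric.tendsto_atTop]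
  intro e he
  have hbdd : BddBelow (range fun x => N x ^ 2 - φ x) := by
    obtain ⟨c, C, hc, hC0, h⟩ := hN
    refine ⟨-(‖φ‖ ^ 2 / (4 * c ^ 2)), ?_⟩
    rintro _ ⟨x, rfl⟩
    have h1 : φ x ≤ ‖φ‖ * ‖x‖ := (le_abs_self _).trans (φ.le_opNorm x)
    have h2 : (c * ‖x‖) ^ 2 ≤ N x ^ 2 := pow_le_pow_left₀ (by positivity) (h x).1 2
    have h3 : ‖φ‖ ^ 2 / (4 * c ^ 2) + (c * ‖x‖) ^ 2 - ‖φ‖ * ‖x‖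
        = (‖φ‖ / (2 * c) - c * ‖x‖) ^ 2 := by field_simp; ring
    have h4 := sq_nonneg (‖φ‖ / (2 * c) - c * ‖x‖)
    simp only
    linarith
  have hδ : 0 < e / (4 * M) := by positivity
  -- An almost minimiser of N² - φ is a point where the derivative of N² is close to φ; continuity
  -- of that derivative then replaces x by its partial sums.
  obtain ⟨x, hx⟩ := exists_forall_le_add_mul_dist
    (J := fun x => N x ^ 2 - φ x) (hsq.continuous.sub φ.continuous) hbdd hδ
  have hJ : HasFDerivAt (fun x => -(N x ^ 2 - φ x)) (-(fderiv ℝ (fun x => N x ^ 2) x - φ)) x :=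
    ((hdiff x).hasFDerivAt.sub φ.hasFDerivAt).neg
  have hclose : ‖φ - fderiv ℝ (fun x => N x ^ 2) x‖ ≤ e / (4 * M) := by
    refine ContinuousLinearMap.opNorm_le_bound _ hδ.le fun v => ?_
    have := hJ.abs_apply_le_seminorm (N := normSeminorm ℝ E) (L := e / (4 * M)) (fun w => by
      have := hx (x + w)
      simp only [dist_self_add_right] at this
      simp only [coe_normSeminorm]
      linarith) v
    rw [neg_sub] at this
    exact this
  have hlim : Tendsto (fun k => fderiv ℝ (fun x => N x ^ 2) (b.proj k x)) atTop
      (𝓝 (fderiv ℝ (fun x => N x ^ 2) x)) :=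
    (hcont.tendsto x).comp (SchauderBasis.tendsto_proj b x)
  obtain ⟨k₀, hk₀⟩ := Metric.tendsto_atTop.1 hlim (e / (4 * M)) hδ
  refine ⟨k₀, fun k hk => ?_⟩
  have hk := hk₀ k hk
  rw [dist_eq_norm] at hk
  rw [dist_zero_right, norm_norm]
  have hle : ‖φ.comp (b.tail k)‖ ≤ e / 2 := by
    refine ContinuousLinearMap.opNorm_le_bound _ (by positivity) fun v => ?_
    have h1 := ContinuousLinearMap.le_opNorm (φ - fderiv ℝ (fun x => N x ^ 2) x) (b.tail k v)
    have h2 := ContinuousLinearMap.le_opNorm (fderiv ℝ (fun x => N x ^ 2) (b.proj k x)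
      - fderiv ℝ (fun x => N x ^ 2) x) (b.tail k v)
    have h3 : ‖b.tail k v‖ ≤ M * ‖v‖ :=
      ((b.tail k).le_opNorm v).trans (by gcongr; exact hM k)
    have h4 : φ (b.tail k v) = (φ - fderiv ℝ (fun x => N x ^ 2) x) (b.tail k v)
        - (fderiv ℝ (fun x => N x ^ 2) (b.proj k x)
      - fderiv ℝ (fun x => N x ^ 2) x) (b.tail k v) := by
      simp only [sub_apply, hzero]
      ring
    rw [ContinuousLinearMap.comp_apply, h4]
    calc _ ≤ ‖φ - fderiv ℝ (fun x => N x ^ 2) x‖ * ‖b.tail k v‖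
          + ‖fderiv ℝ (fun x => N x ^ 2) (b.proj k x) - fderiv ℝ (fun x => N x ^ 2) x‖
            * ‖b.tail k v‖ := (norm_sub_le _ _).trans (add_le_add h1 h2)
      _ ≤ e / (4 * M) * (M * ‖v‖) + e / (4 * M) * (M * ‖v‖) := by gcongr
      _ = e / 2 * ‖v‖ := by field_simp; ring
  linarith

theorem IsOneSuppressionUnconditional.tendsto_norm_comp_tail_euclidean [CompleteSpace E]
    (hb : IsOneSuppressionUnconditional N b) (hN : IsEquivalentNorm N) (hC : IsC1Norm N)
    {d : ℕ} (φ : E →L[ℝ] EuclideanSpace ℝ (Fin d)) :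
    Tendsto (fun k => ‖φ.comp (b.tail k)‖) atTop (𝓝 0) := by
  have h : ∀ i, Tendsto (fun k => ‖((EuclideanSpace.proj i).comp φ).comp (b.tail k)‖) atTop
      (𝓝 0) := fun i => hb.tendsto_norm_comp_tail hN hC _
  have hs := tendsto_finsetSum Finset.univ fun i _ => h i
  rw [Finset.sum_const_zero] at hs
  refine squeeze_zero (fun _ => norm_nonneg _) (fun k => ?_) hs
  refine ContinuousLinearMap.opNorm_le_bound _ (Finset.sum_nonneg fun _ _ => norm_nonneg _)
    fun v => ?_
  have h1 : ‖φ (b.tail k v)‖ ≤ ∑ i, ‖φ (b.tail k v) i‖ := by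
    have e : φ (b.tail k v) = ∑ i, (φ (b.tail k v) i) • EuclideanSpace.single i (1 : ℝ) := by
      have := (EuclideanSpace.basisFun (Fin d) ℝ).sum_repr (φ (b.tail k v))
      simpa using this.symm
    calc ‖φ (b.tail k v)‖ = ‖∑ i, (φ (b.tail k v) i) • EuclideanSpace.single i (1 : ℝ)‖ := by
          rw [← e]
      _ ≤ ∑ i, ‖(φ (b.tail k v) i) • EuclideanSpace.single i (1 : ℝ)‖ := norm_sum_le _ _
      _ = _ := by simp [norm_smul]
  rw [ContinuousLinearMap.comp_apply, Finset.sum_mul]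
  refine h1.trans (Finset.sum_le_sum fun i _ => ?_)
  exact (((EuclideanSpace.proj i).comp φ).comp (b.tail k)).le_opNorm v

end SquaredNorm

/-! ### Derivative of the smooth step -/

section StepFunctions

theorem Real.smoothTransition.hasDerivAt (x : ℝ) :
    HasDerivAt Real.smoothTransition (deriv Real.smoothTransition x) x :=
  (Real.smoothTransition.contDiff.differentiable (n := 1) one_ne_zero x).hasDerivAt

theorem Real.smoothTransition.deriv_nonneg (x : ℝ) : 0 ≤ deriv Real.smoothTransition x :=
  Real.smoothTransition.monotone.deriv_nonneg

theorem Real.smoothTransition.deriv_eq_zero_of_nonpos {x : ℝ} (hx : x ≤ 0) :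
    deriv Real.smoothTransition x = 0 := by
  refine IsLocalMin.deriv_eq_zero (Eventually.of_forall fun y => ?_)
  rw [Real.smoothTransition.zero_of_nonpos hx]
  exact Real.smoothTransition.nonneg y

theorem Real.smoothTransition.deriv_eq_zero_of_one_le {x : ℝ} (hx : 1 ≤ x) :
    deriv Real.smoothTransition x = 0 := by
  refine IsLocalMax.deriv_eq_zero (Eventually.of_forall fun y => ?_)
  rw [Real.smoothTransition.one_of_one_le hx]
  exact Real.smoothTransition.le_one y

theorem Real.smoothTransition.exists_abs_deriv_le :
    ∃ C : ℝ, 1 ≤ C ∧ ∀ x, |deriv Real.smoothTransition x| ≤ C := by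
  have hc : Continuous (deriv Real.smoothTransition) :=
    Real.smoothTransition.contDiff.continuous_deriv (n := 1) le_rfl
  obtain ⟨C, hC⟩ := (isCompact_Icc (a := (0 : ℝ)) (b := 1)).exists_bound_of_continuousOn
    hc.continuousOn
  refine ⟨max C 1, le_max_right _ _, fun x => ?_⟩
  by_cases hx : x ∈ Icc (0 : ℝ) 1
  · exact (hC x hx).trans (le_max_left _ _)
  · have : deriv Real.smoothTransition x = 0 := by
      rcases lt_or_ge x 0 with h | h
      · exact Real.smoothTransition.deriv_eq_zero_of_nonpos h.le
      · refine Real.smoothTransition.deriv_eq_zero_of_one_le ?_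
        by_contra! h1
        exact hx ⟨h, h1.le⟩
    rw [this, abs_zero]
    exact zero_le_one.trans (le_max_right _ _)

end StepFunctions

/-! ### The smoothed tail norm and its partial derivatives -/

section TailSize

variable {E : Type*} [NormedAddCommGroup E] [NormedSpace ℝ E] {N : Seminorm ℝ E}
  {b : SchauderBasis ℝ E}

/-- A positive `C¹` substitute for the norm of the `k`-th tail. -/
noncomputable def tailSize (N : Seminorm ℝ E) (b : SchauderBasis ℝ E) (k : ℕ) (x : E) : ℝ :=
  √(N (b.tail k x) ^ 2 + ((1 / 2 : ℝ) ^ k) ^ 2)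

theorem tailSize_sq (k : ℕ) (x : E) :
    tailSize N b k x ^ 2 = N (b.tail k x) ^ 2 + ((1 / 2 : ℝ) ^ k) ^ 2 :=
  Real.sq_sqrt (by positivity)

theorem tailSize_pos (k : ℕ) (x : E) : 0 < tailSize N b k x := Real.sqrt_pos.2 (by positivity)

theorem pow_le_tailSize (k : ℕ) (x : E) : (1 / 2 : ℝ) ^ k ≤ tailSize N b k x :=
  Real.le_sqrt_of_sq_le (le_add_of_nonneg_left (by positivity))

theorem seminorm_tail_le_tailSize (k : ℕ) (x : E) : N (b.tail k x) ≤ tailSize N b k x :=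
  Real.le_sqrt_of_sq_le (le_add_of_nonneg_right (by positivity))

theorem tailSize_add_le (k : ℕ) (x w : E) :
    tailSize N b k (x + w) ≤ tailSize N b k x + N (b.tail k w) := by
  refine Real.sqrt_le_iff.2 ⟨add_nonneg (tailSize_pos k x).le (apply_nonneg N _), ?_⟩
  have h1 := seminorm_tail_le_tailSize (N := N) (b := b) k x
  have h2 := tailSize_sq (N := N) (b := b) k x
  have h3 : N (b.tail k (x + w)) ≤ N (b.tail k x) + N (b.tail k w) := by
    rw [map_add]; exact map_add_le_add N _ _
  have h4 := pow_le_pow_left₀ (apply_nonneg N _) h3 2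
  have h5 := mul_le_mul_of_nonneg_right h1 (apply_nonneg N (b.tail k w))
  nlinarith

theorem tailSize_anti (hb : IsOneSuppressionUnconditional N b) {k l : ℕ} (h : k ≤ l) (x : E) :
    tailSize N b l x ≤ tailSize N b k x := by
  refine Real.sqrt_le_sqrt (add_le_add ?_ ?_)
  · exact pow_le_pow_left₀ (apply_nonneg N _) (hb.tail_anti h x) 2
  · exact pow_le_pow_left₀ (by positivity)
      (pow_le_pow_of_le_one (by norm_num) (by norm_num) h) 2

theorem tendsto_tailSize (hN : IsEquivalentNorm N) (x : E) :
    Tendsto (fun k => tailSize N b k x) atTop (𝓝 0) := by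
  have h1 : Tendsto (fun k => N (b.tail k x)) atTop (𝓝 0) := by
    have := (hN.continuous.tendsto 0).comp (b.tendsto_tail x)
    rw [map_zero] at this
    exact this
  have h2 : Tendsto (fun k : ℕ => (1 / 2 : ℝ) ^ k) atTop (𝓝 0) :=
    tendsto_pow_atTop_nhds_zero_of_lt_one (by norm_num) (by norm_num)
  simpa [tailSize] using ((h1.pow 2).add (h2.pow 2)).sqrt

theorem contDiff_tailSize (hN : IsEquivalentNorm N) (hC : IsC1Norm N) (k : ℕ) :
    ContDiff ℝ 1 (tailSize N b k) := by
  have h1 : ContDiff ℝ 1 fun x => N (b.tail k x) ^ 2 :=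
    (hC.contDiff_sq hN).comp (b.tail k).contDiff
  exact (h1.add contDiff_const).sqrt fun x => by positivity

theorem hasFDerivAt_tailSize (hN : IsEquivalentNorm N) (hC : IsC1Norm N) (k : ℕ) (x : E) :
    HasFDerivAt (tailSize N b k) (fderiv ℝ (tailSize N b k) x) x :=
  ((contDiff_tailSize hN hC k).differentiable one_ne_zero x).hasFDerivAt

theorem abs_fderiv_tailSize_le (hN : IsEquivalentNorm N) (hC : IsC1Norm N) (k : ℕ) (x v : E) :
    |fderiv ℝ (tailSize N b k) x v| ≤ N (b.tail k v) := by
  have := (hasFDerivAt_tailSize (b := b) hN hC k x).abs_apply_le_seminorm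
    (N := N.comp (b.tail k : E →ₗ[ℝ] E)) (L := 1) (fun w => by
      have := tailSize_add_le (N := N) (b := b) k x w
      rw [Seminorm.comp_apply]
      simp only [ContinuousLinearMap.coe_coe]
      linarith) v
  rw [one_mul] at this
  exact this

theorem fderiv_tailSize_basis_of_lt (hN : IsEquivalentNorm N) (hC : IsC1Norm N) {j k : ℕ}
    (h : j < k) (x : E) : fderiv ℝ (tailSize N b k) x (b j) = 0 := by
  have := abs_fderiv_tailSize_le (b := b) hN hC k x (b j)
  rw [b.tail_basis_of_lt h, map_zero] at this
  exact abs_nonpos_iff.1 this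

/-- Moving the j-th coordinate towards 0 does not increase the tail norm. -/
theorem coord_mul_fderiv_tailSize_nonneg (hb : IsOneSuppressionUnconditional N b)
    (hN : IsEquivalentNorm N) (hC : IsC1Norm N) (j k : ℕ) (x : E) :
    0 ≤ b.coord j x * fderiv ℝ (tailSize N b k) x (b j) := by
  rcases lt_or_ge j k with h | h
  · rw [fderiv_tailSize_basis_of_lt hN hC h, mul_zero]
  have := (hasFDerivAt_tailSize (b := b) hN hC k x).apply_le_of_forall_pos
    (v := -(b.coord j x • b j)) (L := 0) (fun s hs hs1 => by
      have e : b.tail k (x + s • -(b.coord j x • b j))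
          = b.tail k x - (s * b.coord j (b.tail k x)) • b j := by
        rw [b.coord_tail, if_pos h, map_add, map_smul, map_neg, map_smul, b.tail_basis_of_le h]
        module
      have h1 : N (b.tail k (x + s • -(b.coord j x • b j))) ≤ N (b.tail k x) := by
        rw [e]
        exact hb.sub_smul_le _ _ hs.le hs1
      have h2 : tailSize N b k (x + s • -(b.coord j x • b j)) ≤ tailSize N b k x :=
        Real.sqrt_le_sqrt (add_le_add (pow_le_pow_left₀ (apply_nonneg N _) h1 2) le_rfl)
      linarith)
  rw [map_neg, map_smul, smul_eq_mul] at this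
  linarith

theorem IsStrictlyConvexNorm.midpoint_lt (hS : IsStrictlyConvexNorm N) {x y : E} (hx : 0 < N x)
    (hyx : N y ≤ N x) (hne : x ≠ y) : N ((1 / 2 : ℝ) • (x + y)) < N x := by
  rcases hyx.lt_or_eq with h | h
  · rw [map_smul_eq_mul]
    have := map_add_le_add N x y
    norm_num
    linarith
  · have e : (1 / 2 : ℝ) • (x + y)
        = N x • ((1 / 2 : ℝ) • ((N x)⁻¹ • x + (N x)⁻¹ • y)) := by
      rw [← smul_add, smul_comm (N x), smul_smul (N x), mul_inv_cancel₀ hx.ne', one_smul]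
    have h1 : ∀ z, N z = N x → N ((N x)⁻¹ • z) = 1 := fun z hz => by
      rw [map_smul_eq_mul, hz, norm_inv, Real.norm_of_nonneg hx.le, inv_mul_cancel₀ hx.ne']
    have h2 := hS _ _ (h1 x rfl) (h1 y h) (by
      intro h; exact hne (smul_right_injective E (inv_ne_zero hx.ne') h))
    rw [e, map_smul_eq_mul, Real.norm_of_nonneg hx.le]
    nlinarith

/-- Halving a nonzero coordinate strictly decreases the norm, because the result is the midpoint of
two distinct vectors, the second no longer than the first. By convexity the decrease has a positive
linear rate, so the derivative cannot vanish. -/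
theorem coord_eq_zero_of_fderiv_tailSize_eq_zero (hb : IsOneSuppressionUnconditional N b)
    (hN : IsEquivalentNorm N) (hC : IsC1Norm N) (hS : IsStrictlyConvexNorm N) {j k : ℕ}
    (h : k ≤ j) {x : E} (h0 : fderiv ℝ (tailSize N b k) x (b j) = 0) : b.coord j x = 0 := by
  by_contra hx
  set z := b.tail k x with hz
  have hcz : b.coord j z = b.coord j x := by rw [hz, b.coord_tail, if_pos h]
  have hz0 : z ≠ 0 := by rintro h; rw [h, map_zero] at hcz; exact hx hcz.symm
  have hb0 : b j ≠ 0 := by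
    intro h; have := b.coord_self j; rw [h, map_zero] at this; exact zero_ne_one this
  have hmid : N ((1 / 2 : ℝ) • (z + (z - b.coord j z • b j))) < N z := by
    refine hS.midpoint_lt (hN.pos hz0) (hb z j) ?_
    rw [hcz]
    intro h
    have : b.coord j x • b j = 0 := by
      have := sub_eq_zero.2 h; simpa using this
    exact (smul_ne_zero hx hb0) this
  set m := (1 / 2 : ℝ) • (z + (z - b.coord j z • b j)) with hm
  have hd := (hasFDerivAt_tailSize (b := b) hN hC k x).pow 2
  -- With Δ = N z - N m, the square drops by at least 2sΔ N z - s²Δ², and s²Δ² ≤ sΔ N z; this leaves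
  -- the slope -Δ N z.
  have := hd.apply_le_of_forall_pos (v := -((b.coord j x / 2) • b j))
    (L := -((N z - N m) * N z)) (fun s hs hs1 => by
      rw [tailSize_sq, tailSize_sq]
      have e : b.tail k (x + s • -((b.coord j x / 2) • b j)) = (1 - s) • z + s • m := by
        rw [hm, hcz, map_add, map_smul, map_neg, map_smul, b.tail_basis_of_le h]
        module
      have h1 : N (b.tail k (x + s • -((b.coord j x / 2) • b j))) ≤ (1 - s) * N z + s * N m := by
        rw [e]
        refine (map_add_le_add N _ _).trans ?_
        rw [map_smul_eq_mul, map_smul_eq_mul, Real.norm_of_nonneg hs.le,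
          Real.norm_of_nonneg (by linarith)]
      have h2 := pow_le_pow_left₀ (apply_nonneg N _) h1 2
      have hm0 := apply_nonneg N m
      have h3 : s * (N z - N m) * (s * (N z - N m)) ≤ s * (N z - N m) * N z := by
        refine mul_le_mul_of_nonneg_left ?_ (mul_nonneg hs.le (by linarith))
        nlinarith
      rw [← hz]
      nlinarith)
  rw [map_neg, map_smul, smul_apply, h0] at this
  simp only [smul_zero, neg_zero] at this
  nlinarith [hN.pos hz0]

end TailSize

/-! ### Frozen sums: monotonicity, smoothness and injectivity of the differential -/

section Freezing

variable {E : Type*} [NormedAddCommGroup E] [NormedSpace ℝ E] {N : Seminorm ℝ E}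
  {b : SchauderBasis ℝ E}

theorem IsOneSuppressionUnconditional.sum_tail_le_of_eq_zero
    (hb : IsOneSuppressionUnconditional N b) (hN : IsEquivalentNorm N) (s : Finset ℕ) (a : ℕ → ℝ)
    {k : ℕ} (hs : ∀ l ∈ s, l < k → a l = 0) {M : ℝ} (hM : 0 ≤ M)
    (h : ∀ l ∈ s, k ≤ l → |a l| ≤ M) (x : E) :
    N (∑ l ∈ s, (a l * b.coord l x) • b l) ≤ 2 * M * N (b.tail k x) := by
  have e : ∑ l ∈ s with k ≤ l, (a l * b.coord l x) • b l = ∑ l ∈ s, (a l * b.coord l x) • b l := by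
    refine Finset.sum_filter_of_ne fun l hl hne => ?_
    by_contra hlt
    rw [hs l hl (not_le.1 hlt)] at hne
    simp at hne
  rw [← e]
  refine hb.sum_tail_le_of_abs_le hN _ a (fun l hl => (Finset.mem_filter.1 hl).2) hM
    (fun l hl => ?_) x
  exact h l (Finset.mem_filter.1 hl).1 (Finset.mem_filter.1 hl).2

/-- An increasing family of nonnegative `C¹` functions that are `L`-Lipschitz for `N`. -/
structure IsRadiusFamily (N : Seminorm ℝ E) (L : ℝ) (τ : ℕ → E → ℝ) : Prop where
  contDiff : ∀ k, ContDiff ℝ 1 (τ k)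
  nonneg : ∀ k y, 0 ≤ τ k y
  mono : ∀ y, Monotone fun k => τ k y
  add_le : ∀ k y w, τ k (y + w) ≤ τ k y + L * N w

/-- The partial sums of the expansion of `x`, frozen smoothly once the tail is small compared with
the radius at the current partial sum. -/
noncomputable def frozenSum (N : Seminorm ℝ E) (b : SchauderBasis ℝ E) (τ : ℕ → E → ℝ) :
    ℕ → E → E
  | 0, _ => 0
  | k + 1, x => frozenSum N b τ k x +
      (Real.smoothTransition (2 - τ k (frozenSum N b τ k x) / tailSize N b k x) * b.coord k x) • b k

/-- The radius at the `k`-th frozen sum of `x`, relative to the size of the `k`-th tail of `x`. -/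
noncomputable def radiusRatio (N : Seminorm ℝ E) (b : SchauderBasis ℝ E) (τ : ℕ → E → ℝ)
    (k : ℕ) (x : E) : ℝ :=
  τ k (frozenSum N b τ k x) / tailSize N b k x

variable {L : ℝ} {τ : ℕ → E → ℝ}

theorem frozenSum_succ (k : ℕ) (x : E) : frozenSum N b τ (k + 1) x = frozenSum N b τ k x +
    (Real.smoothTransition (2 - radiusRatio N b τ k x) * b.coord k x) • b k := rfl

theorem radius_eq (k : ℕ) (x : E) :
    τ k (frozenSum N b τ k x) = radiusRatio N b τ k x * tailSize N b k x := by
  rw [radiusRatio, div_mul_cancel₀ _ (tailSize_pos k x).ne']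

theorem frozenSum_eq_sum (k : ℕ) (x : E) : frozenSum N b τ k x = ∑ l ∈ Finset.range k,
    (Real.smoothTransition (2 - radiusRatio N b τ l x) * b.coord l x) • b l := by
  induction k with
  | zero => rfl
  | succ k ih => rw [frozenSum_succ, Finset.sum_range_succ, ih]

theorem frozenSum_eq_proj {k : ℕ} {x : E} (h : ∀ l < k, radiusRatio N b τ l x ≤ 1) :
    frozenSum N b τ k x = b.proj k x := by
  rw [frozenSum_eq_sum, SchauderBasis.proj_apply]
  refine Finset.sum_congr rfl fun l hl => ?_
  rw [Real.smoothTransition.one_of_one_le (by linarith [h l (Finset.mem_range.1 hl)]), one_mul]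

theorem IsRadiusFamily.radiusRatio_nonneg (hτ : IsRadiusFamily N L τ) (k : ℕ) (x : E) :
    0 ≤ radiusRatio N b τ k x :=
  div_nonneg (hτ.nonneg _ _) (tailSize_pos _ _).le

theorem frozenSum_succ_of_two_le {k : ℕ} {x : E} (h : 2 ≤ radiusRatio N b τ k x) :
    frozenSum N b τ (k + 1) x = frozenSum N b τ k x := by
  rw [frozenSum_succ, Real.smoothTransition.zero_of_nonpos (by linarith)]
  simp

/-- Once the sum is frozen, the numerator can only grow with the index and the denominator can only
shrink. -/
theorem IsRadiusFamily.radiusRatio_le_succ (hτ : IsRadiusFamily N L τ)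
    (hb : IsOneSuppressionUnconditional N b) {k : ℕ} {x : E} (h : 2 ≤ radiusRatio N b τ k x) :
    radiusRatio N b τ k x ≤ radiusRatio N b τ (k + 1) x := by
  rw [radiusRatio, radiusRatio, frozenSum_succ_of_two_le h]
  exact div_le_div₀ (hτ.nonneg _ _) (hτ.mono _ k.le_succ) (tailSize_pos _ _)
    (tailSize_anti hb k.le_succ x)

theorem IsRadiusFamily.radiusRatio_mono (hτ : IsRadiusFamily N L τ)
    (hb : IsOneSuppressionUnconditional N b) {k l : ℕ} (hkl : k ≤ l) {x : E}
    (h : 2 ≤ radiusRatio N b τ k x) : radiusRatio N b τ k x ≤ radiusRatio N b τ l x := by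
  induction l, hkl using Nat.le_induction with
  | base => exact le_rfl
  | succ l _ ih => exact ih.trans (hτ.radiusRatio_le_succ hb (h.trans ih))

theorem IsRadiusFamily.frozenSum_eq (hτ : IsRadiusFamily N L τ)
    (hb : IsOneSuppressionUnconditional N b) {k l : ℕ} (hkl : k ≤ l) {x : E}
    (h : 2 ≤ radiusRatio N b τ k x) : frozenSum N b τ l x = frozenSum N b τ k x := by
  induction l, hkl using Nat.le_induction with
  | base => rfl
  | succ l hl ih =>
    rw [frozenSum_succ_of_two_le (h.trans (hτ.radiusRatio_mono hb hl h)), ih]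

theorem IsRadiusFamily.contDiff_radiusRatio_of (hτ : IsRadiusFamily N L τ)
    (hN : IsEquivalentNorm N) (hC : IsC1Norm N) {k : ℕ}
    (h : ContDiff ℝ 1 (frozenSum N b τ k)) : ContDiff ℝ 1 (radiusRatio N b τ k) :=
  ((hτ.contDiff k).comp h).div (contDiff_tailSize hN hC k) fun x => (tailSize_pos k x).ne'

theorem IsRadiusFamily.contDiff_frozenSum (hτ : IsRadiusFamily N L τ)
    (hN : IsEquivalentNorm N) (hC : IsC1Norm N) (k : ℕ) :
    ContDiff ℝ 1 (frozenSum N b τ k) := by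
  induction k with
  | zero => exact contDiff_const
  | succ k ih =>
    have h1 := hτ.contDiff_radiusRatio_of hN hC ih
    exact ih.add (((Real.smoothTransition.contDiff.comp (contDiff_const.sub h1)).mul
      (b.coord k).contDiff).smul contDiff_const)

theorem IsRadiusFamily.contDiff_radiusRatio (hτ : IsRadiusFamily N L τ)
    (hN : IsEquivalentNorm N) (hC : IsC1Norm N) (k : ℕ) :
    ContDiff ℝ 1 (radiusRatio N b τ k) :=
  hτ.contDiff_radiusRatio_of hN hC (hτ.contDiff_frozenSum hN hC k)

theorem IsRadiusFamily.hasFDerivAt_frozenSum (hτ : IsRadiusFamily N L τ)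
    (hN : IsEquivalentNorm N) (hC : IsC1Norm N) (k : ℕ) (x : E) :
    HasFDerivAt (frozenSum N b τ k) (fderiv ℝ (frozenSum N b τ k) x) x :=
  ((hτ.contDiff_frozenSum hN hC k).differentiable one_ne_zero x).hasFDerivAt

theorem IsRadiusFamily.hasFDerivAt_radiusRatio (hτ : IsRadiusFamily N L τ)
    (hN : IsEquivalentNorm N) (hC : IsC1Norm N) (k : ℕ) (x : E) :
    HasFDerivAt (radiusRatio N b τ k) (fderiv ℝ (radiusRatio N b τ k) x) x :=
  ((hτ.contDiff_radiusRatio hN hC k).differentiable one_ne_zero x).hasFDerivAt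

theorem IsRadiusFamily.hasFDerivAt (hτ : IsRadiusFamily N L τ) (k : ℕ) (y : E) :
    HasFDerivAt (τ k) (fderiv ℝ (τ k) y) y :=
  ((hτ.contDiff k).differentiable one_ne_zero y).hasFDerivAt

theorem IsRadiusFamily.abs_fderiv_le (hτ : IsRadiusFamily N L τ) (k : ℕ) (y v : E) :
    |fderiv ℝ (τ k) y v| ≤ L * N v :=
  (hτ.hasFDerivAt k y).abs_apply_le_seminorm (fun w => by linarith [hτ.add_le k y w]) v

theorem IsRadiusFamily.fderiv_radiusRatio_apply (hτ : IsRadiusFamily N L τ)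
    (hN : IsEquivalentNorm N) (hC : IsC1Norm N) (k : ℕ) (x v : E) :
    fderiv ℝ (radiusRatio N b τ k) x v =
      (fderiv ℝ (τ k) (frozenSum N b τ k x) (fderiv ℝ (frozenSum N b τ k) x v)
        - radiusRatio N b τ k x * fderiv ℝ (tailSize N b k) x v) / tailSize N b k x := by
  have h1 : HasFDerivAt (fun x => τ k (frozenSum N b τ k x)) _ x :=
    (hτ.hasFDerivAt k _).comp x (hτ.hasFDerivAt_frozenSum hN hC k x)
  have h2 : HasFDerivAt (fun x => radiusRatio N b τ k x * tailSize N b k x) _ x :=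
    (hτ.hasFDerivAt_radiusRatio (b := b) hN hC k x).mul (hasFDerivAt_tailSize hN hC k x)
  have e : (fun x => τ k (frozenSum N b τ k x))
      = fun x => radiusRatio N b τ k x * tailSize N b k x := funext fun x => radius_eq k x
  rw [e] at h1
  have h3 := DFunLike.congr_fun (h1.unique h2) v
  simp only [ContinuousLinearMap.comp_apply, add_apply, smul_apply, smul_eq_mul] at h3
  rw [eq_div_iff (tailSize_pos k x).ne', h3]
  ring

theorem IsRadiusFamily.fderiv_frozenSum_succ_apply (hτ : IsRadiusFamily N L τ)
    (hN : IsEquivalentNorm N) (hC : IsC1Norm N) (k : ℕ) (x v : E) :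
    fderiv ℝ (frozenSum N b τ (k + 1)) x v = fderiv ℝ (frozenSum N b τ k) x v +
      (Real.smoothTransition (2 - radiusRatio N b τ k x) * b.coord k v -
        deriv Real.smoothTransition (2 - radiusRatio N b τ k x) *
          fderiv ℝ (radiusRatio N b τ k) x v * b.coord k x) • b k := by
  have h1 := (Real.smoothTransition.hasDerivAt (2 - radiusRatio N b τ k x)).comp_hasFDerivAt x
    ((hτ.hasFDerivAt_radiusRatio (b := b) hN hC k x).const_sub 2)
  have h2 := (hτ.hasFDerivAt_frozenSum (b := b) hN hC k x).add
    ((h1.mul (b.coord k).hasFDerivAt).smul_const (b k))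
  have h3 : HasFDerivAt (frozenSum N b τ (k + 1)) _ x := h2
  rw [h3.fderiv]
  simp only [Function.comp_apply, add_apply, smul_apply, smul_eq_mul, neg_apply,
    ContinuousLinearMap.smulRight_apply]
  congr 2
  ring

theorem IsRadiusFamily.fderiv_frozenSum_apply (hτ : IsRadiusFamily N L τ)
    (hN : IsEquivalentNorm N) (hC : IsC1Norm N) (k : ℕ) (x v : E) :
    fderiv ℝ (frozenSum N b τ k) x v =
      ∑ l ∈ Finset.range k,
        (Real.smoothTransition (2 - radiusRatio N b τ l x) * b.coord l v) • b l +
      ∑ l ∈ Finset.range k, (-(deriv Real.smoothTransition (2 - radiusRatio N b τ l x) *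
          fderiv ℝ (radiusRatio N b τ l) x v) * b.coord l x) • b l := by
  induction k with
  | zero =>
    have : HasFDerivAt (frozenSum N b τ 0) (0 : E →L[ℝ] E) x := hasFDerivAt_const _ _
    simp [this.fderiv]
  | succ k ih =>
    rw [hτ.fderiv_frozenSum_succ_apply hN hC, ih, Finset.sum_range_succ, Finset.sum_range_succ]
    module

theorem IsRadiusFamily.coord_fderiv_frozenSum (hτ : IsRadiusFamily N L τ)
    (hN : IsEquivalentNorm N) (hC : IsC1Norm N) {j k : ℕ} (h : k ≤ j) (x v : E) :
    b.coord j (fderiv ℝ (frozenSum N b τ k) x v) = 0 := by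
  rw [hτ.fderiv_frozenSum_apply hN hC, map_add, b.coord_sum, b.coord_sum]
  simp [not_lt.2 h]

theorem IsRadiusFamily.tail_fderiv_frozenSum (hτ : IsRadiusFamily N L τ)
    (hN : IsEquivalentNorm N) (hC : IsC1Norm N) (k : ℕ) (x v : E) :
    b.tail k (fderiv ℝ (frozenSum N b τ k) x v) = 0 := by
  rw [hτ.fderiv_frozenSum_apply hN hC, map_add, map_sum, map_sum, Finset.sum_eq_zero,
    Finset.sum_eq_zero, add_zero]
  all_goals
    intro l hl
    rw [map_smul, b.tail_basis_of_lt (Finset.mem_range.1 hl), smul_zero]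

theorem IsRadiusFamily.fderiv_frozenSum_eq (hτ : IsRadiusFamily N L τ)
    (hb : IsOneSuppressionUnconditional N b) (hN : IsEquivalentNorm N) (hC : IsC1Norm N)
    {k l : ℕ} (hkl : k ≤ l) {x : E} (h : 2 ≤ radiusRatio N b τ k x) :
    fderiv ℝ (frozenSum N b τ l) x = fderiv ℝ (frozenSum N b τ k) x := by
  induction l, hkl using Nat.le_induction with
  | base => rfl
  | succ l hl ih =>
    have h2 := h.trans (hτ.radiusRatio_mono hb hl h)
    ext v
    rw [hτ.fderiv_frozenSum_succ_apply hN hC, ih,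
      Real.smoothTransition.zero_of_nonpos (by linarith),
      Real.smoothTransition.deriv_eq_zero_of_nonpos (by linarith)]
    simp

/-- As long as the sum is not frozen, its differential is injective on the span of the basis
vectors seen so far. -/
theorem IsRadiusFamily.eq_zero_of_fderiv_frozenSum_eq_zero (hτ : IsRadiusFamily N L τ)
    (hb : IsOneSuppressionUnconditional N b) (hN : IsEquivalentNorm N) (hC : IsC1Norm N)
    {m : ℕ} {x : E} (h : ∀ l < m, radiusRatio N b τ l x < 2) {v : E} (hv : b.tail m v = 0)
    (h0 : fderiv ℝ (frozenSum N b τ m) x v = 0) : v = 0 := by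
  induction m generalizing v with
  | zero => simpa [b.tail_apply, SchauderBasis.proj_apply] using hv
  | succ m ih =>
    rw [hτ.fderiv_frozenSum_succ_apply hN hC] at h0
    have hc := congrArg (b.coord m) h0
    rw [map_add, hτ.coord_fderiv_frozenSum hN hC le_rfl, zero_add, map_smul, b.coord_self,
      map_zero, smul_eq_mul, mul_one] at hc
    rw [hc, zero_smul, add_zero] at h0
    have htail : b.tail m v = b.coord m v • b m := by
      have h1 : b.tail m v - b.tail (m + 1) v = b.coord m v • b m := by
        rw [b.tail_apply, b.tail_apply, SchauderBasis.proj_apply, SchauderBasis.proj_apply,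
          Finset.sum_range_succ]
        abel
      rwa [hv, sub_zero] at h1
    have hD : fderiv ℝ (tailSize N b m) x v
        = b.coord m v * fderiv ℝ (tailSize N b m) x (b m) := by
      have h1 := abs_fderiv_tailSize_le (b := b) hN hC m x (v - b.coord m v • b m)
      rw [map_sub (b.tail m), htail, map_smul (b.tail m), b.tail_basis_of_le le_rfl, sub_self,
        map_zero] at h1
      have h2 := abs_nonpos_iff.1 h1
      rw [map_sub, map_smul, smul_eq_mul, sub_eq_zero] at h2
      exact h2
    rw [hτ.fderiv_radiusRatio_apply hN hC, h0, map_zero, hD] at hc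
    have hpos : 0 < Real.smoothTransition (2 - radiusRatio N b τ m x) := by
      refine (Real.smoothTransition.nonneg _).lt_of_ne' fun h1 => ?_
      rw [Real.smoothTransition.zero_iff_nonpos] at h1
      linarith [h m m.lt_succ_self]
    have hnn : 0 ≤ deriv Real.smoothTransition (2 - radiusRatio N b τ m x) *
        (radiusRatio N b τ m x / tailSize N b m x) *
          (b.coord m x * fderiv ℝ (tailSize N b m) x (b m)) :=
      mul_nonneg (mul_nonneg (Real.smoothTransition.deriv_nonneg _)
        (div_nonneg (hτ.radiusRatio_nonneg _ _) (tailSize_pos _ _).le))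
        (coord_mul_fderiv_tailSize_nonneg hb hN hC m m x)
    -- The differential is triangular in the basis. Its m-th diagonal entry is the value of the
    -- step, which is positive, plus a term that suppression makes nonnegative.
    have hvm : b.coord m v = 0 := by
      have h1 : b.coord m v * (Real.smoothTransition (2 - radiusRatio N b τ m x) +
          deriv Real.smoothTransition (2 - radiusRatio N b τ m x) *
          (radiusRatio N b τ m x / tailSize N b m x) *
          (b.coord m x * fderiv ℝ (tailSize N b m) x (b m))) = 0 := by
        rw [← hc]; ring
      rcases mul_eq_zero.1 h1 with h2 | h2
      · exact h2
      · linarith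
    refine ih (fun l hl => h l (hl.trans m.lt_succ_self)) ?_ h0
    rw [htail, hvm, zero_smul]

/-- The differential maps E into the span of the first m basis vectors and is injective, hence
bijective, on that finite-dimensional span. Every value is therefore already taken on the span. -/
theorem IsRadiusFamily.comp_fderiv_frozenSum_eq_zero (hτ : IsRadiusFamily N L τ)
    (hb : IsOneSuppressionUnconditional N b) (hN : IsEquivalentNorm N) (hC : IsC1Norm N)
    {m : ℕ} {x : E} (h : ∀ l < m, radiusRatio N b τ l x < 2) {φ : E →L[ℝ] ℝ}
    (hφ : ∀ j < m, φ (fderiv ℝ (frozenSum N b τ m) x (b j)) = 0) (v : E) :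
    φ (fderiv ℝ (frozenSum N b τ m) x v) = 0 := by
  set D := fderiv ℝ (frozenSum N b τ m) x
  set F : Submodule ℝ E := (b.proj m).range with hF
  have hspan : F = Submodule.span ℝ (b '' (Finset.range m : Set ℕ)) := by
    rw [hF, SchauderBasis.range_proj_eq_span]
  have hmem : ∀ w, w ∈ F ↔ b.tail m w = 0 := by
    intro w
    rw [b.tail_apply, sub_eq_zero]
    constructor
    · rintro ⟨u, rfl⟩
      have := SchauderBasis.proj_comp b m m u
      simp at this ⊢
      exact this.symm
    · intro hw
      exact ⟨w, hw.symm⟩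
  have hDF : ∀ w, D w ∈ F := fun w => (hmem _).2 (hτ.tail_fderiv_frozenSum hN hC m x w)
  have hfin : FiniteDimensional ℝ F := by
    rw [hspan]
    exact FiniteDimensional.span_of_finite ℝ ((Finset.finite_toSet _).image _)
  let DF : F →ₗ[ℝ] F := (D : E →ₗ[ℝ] E).restrict fun w _ => hDF w
  have hinj : Function.Injective DF := by
    rw [injective_iff_map_eq_zero]
    intro w hw
    have h1 : D w = 0 := congrArg Subtype.val hw
    exact Subtype.ext (hτ.eq_zero_of_fderiv_frozenSum_eq_zero hb hN hC h ((hmem _).1 w.2) h1)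
  obtain ⟨w, hw⟩ := LinearMap.injective_iff_surjective.1 hinj ⟨D v, hDF v⟩
  have hw' : D w = D v := congrArg Subtype.val hw
  rw [← hw']
  have hle : F ≤ (φ.comp D : E →ₗ[ℝ] ℝ).ker := by
    rw [hspan, Submodule.span_le]
    rintro _ ⟨i, hi, rfl⟩
    exact hφ i (Finset.mem_range.1 hi)
  exact hle w.2

end Freezing

/-! ### The first dominated index and the uniform bound on the differential -/

section Freezing

variable {E : Type*} [NormedAddCommGroup E] [NormedSpace ℝ E] {N : Seminorm ℝ E}
  {b : SchauderBasis ℝ E} {L : ℝ} {τ : ℕ → E → ℝ}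

/-- `m` is the first index at which the radius dominates the size of the tail. -/
def IsFirstDominated (N : Seminorm ℝ E) (b : SchauderBasis ℝ E) (τ : ℕ → E → ℝ) (m : ℕ)
    (x : E) : Prop :=
  (∀ l < m, radiusRatio N b τ l x < 1) ∧ 1 ≤ radiusRatio N b τ m x

theorem exists_isFirstDominated (hN : IsEquivalentNorm N) {x : E} {c : ℝ} (hc : 0 < c) {k₀ : ℕ}
    (h : ∀ᶠ y in 𝓝 x, ∀ k ≥ k₀, c ≤ τ k y) : ∃ m, IsFirstDominated N b τ m x := by
  classical
  have hex : ∃ m, 1 ≤ radiusRatio N b τ m x := by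
    -- Otherwise nothing is ever truncated, so the sums converge to x, where the radii stay above c,
    -- while the tail sizes tend to 0.
    by_contra! hlt
    have hproj : ∀ k, frozenSum N b τ k x = b.proj k x :=
      fun k => frozenSum_eq_proj fun l _ => (hlt l).le
    have h1 := (SchauderBasis.tendsto_proj b x).eventually h
    have h2 := (tendsto_tailSize (b := b) hN x).eventually (gt_mem_nhds hc)
    obtain ⟨k, hk, hk2, hk3⟩ := (h1.and (h2.and (eventually_ge_atTop k₀))).exists
    have h4 := hk k hk3
    have h5 := hlt k
    rw [radiusRatio, hproj, div_lt_one (tailSize_pos k x)] at h5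
    linarith
  exact ⟨Nat.find hex, fun l hl => not_le.1 (Nat.find_min hex hl), Nat.find_spec hex⟩

namespace IsFirstDominated

variable {m : ℕ} {x : E}

theorem frozenSum_eq (h : IsFirstDominated N b τ m x) : frozenSum N b τ m x = b.proj m x :=
  frozenSum_eq_proj fun l hl => (h.1 l hl).le

theorem le_of_le_radiusRatio (h : IsFirstDominated N b τ m x) {j : ℕ}
    (hj : 1 ≤ radiusRatio N b τ j x) : m ≤ j := by
  by_contra! hlt
  exact absurd (h.1 j hlt) (not_lt.2 hj)

theorem tailSize_le (h : IsFirstDominated N b τ m x) :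
    tailSize N b m x ≤ τ m (b.proj m x) := by
  rw [← h.frozenSum_eq, radius_eq (N := N) (b := b) (τ := τ)]
  exact le_mul_of_one_le_left (tailSize_pos m x).le h.2

theorem tail_le (h : IsFirstDominated N b τ m x) : N (b.tail m x) ≤ τ m (b.proj m x) :=
  (seminorm_tail_le_tailSize m x).trans h.tailSize_le

theorem frozenSum_sub_le (h : IsFirstDominated N b τ m x)
    (hb : IsOneSuppressionUnconditional N b) (hN : IsEquivalentNorm N) {j : ℕ} (hj : m ≤ j) :
    N (frozenSum N b τ j x - b.proj m x) ≤ N (b.tail m x) := by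
  have e : frozenSum N b τ j x - b.proj m x = ∑ l ∈ Finset.Ico m j,
      (Real.smoothTransition (2 - radiusRatio N b τ l x) * b.coord l x) • b l := by
    rw [← h.frozenSum_eq, frozenSum_eq_sum, frozenSum_eq_sum,
      ← Finset.sum_range_add_sum_Ico _ hj]
    abel
  rw [e]
  exact hb.sum_tail_le hN _ _ (fun l hl => (Finset.mem_Ico.1 hl).1)
    (fun l _ => Real.smoothTransition.nonneg _) (fun l _ => Real.smoothTransition.le_one _) x

theorem radius_le (h : IsFirstDominated N b τ m x) (hτ : IsRadiusFamily N L τ)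
    (hb : IsOneSuppressionUnconditional N b) (hN : IsEquivalentNorm N)
    (hL : L ≤ 1 / 2) {j : ℕ} (hj : m ≤ j) :
    τ m (b.proj m x) ≤ 2 * (radiusRatio N b τ j x * tailSize N b j x) := by
  have h1 := h.frozenSum_sub_le hb hN hj
  have h2 := hτ.add_le m (frozenSum N b τ j x) (b.proj m x - frozenSum N b τ j x)
  rw [add_sub_cancel, map_sub_rev] at h2
  have h3 : τ m (frozenSum N b τ j x) ≤ τ j (frozenSum N b τ j x) := hτ.mono _ hj
  rw [radius_eq (N := N) (b := b) (τ := τ)] at h3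
  have h4 := h.tail_le
  have h5 := apply_nonneg N (b.tail m x)
  have h6 : L * N (frozenSum N b τ j x - b.proj m x) ≤ 1 / 2 * τ m (b.proj m x) :=
    mul_le_mul hL (h1.trans h4) (apply_nonneg N _) (by norm_num)
  linarith

theorem tailSize_le_mul (h : IsFirstDominated N b τ m x) (hτ : IsRadiusFamily N L τ)
    (hb : IsOneSuppressionUnconditional N b) (hN : IsEquivalentNorm N)
    (hL : L ≤ 1 / 2) {j : ℕ} (hj : m ≤ j) {R : ℝ}
    (hR : radiusRatio N b τ j x ≤ R) :
    tailSize N b m x ≤ 2 * R * tailSize N b j x := by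
  have h1 := h.tailSize_le.trans (h.radius_le hτ hb hN hL hj)
  have h2 := mul_le_mul_of_nonneg_right hR (tailSize_pos (N := N) (b := b) j x).le
  linarith

theorem exists_lt_radiusRatio (h : IsFirstDominated N b τ m x) (hτ : IsRadiusFamily N L τ)
    (hb : IsOneSuppressionUnconditional N b) (hN : IsEquivalentNorm N)
    (hL : L ≤ 1 / 2) (R : ℝ) : ∃ k, R < radiusRatio N b τ k x := by
  by_contra! hR
  have h1 : ∀ j ≥ m, tailSize N b m x ≤ 2 * R * tailSize N b j x :=
    fun j hj => h.tailSize_le_mul hτ hb hN hL hj (hR j)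
  have h2 : Tendsto (fun j => 2 * R * tailSize N b j x) atTop (𝓝 0) := by
    simpa using (tendsto_tailSize (b := b) hN x).const_mul (2 * R)
  have h3 : tailSize N b m x ≤ 0 :=
    ge_of_tendsto h2 (eventually_atTop.2 ⟨m, h1⟩)
  exact absurd h3 (not_le.2 (tailSize_pos m x))

theorem tail_fderiv_frozenSum_sub (h : IsFirstDominated N b τ m x) (hτ : IsRadiusFamily N L τ)
    (hN : IsEquivalentNorm N) (hC : IsC1Norm N) {j : ℕ} (hj : m ≤ j) (v : E) :
    b.tail m (fderiv ℝ (frozenSum N b τ j) x v - v) = fderiv ℝ (frozenSum N b τ j) x v - v := by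
  induction j, hj using Nat.le_induction with
  | base =>
    have e : fderiv ℝ (frozenSum N b τ m) x v = b.proj m v := by
      rw [hτ.fderiv_frozenSum_apply hN hC, SchauderBasis.proj_apply,
        Finset.sum_eq_zero (s := Finset.range m) (f := fun l =>
          (-(deriv Real.smoothTransition (2 - radiusRatio N b τ l x) *
          fderiv ℝ (radiusRatio N b τ l) x v) * b.coord l x) • b l), add_zero]
      · refine Finset.sum_congr rfl fun l hl => ?_
        rw [Real.smoothTransition.one_of_one_le (by linarith [h.1 l (Finset.mem_range.1 hl)]),
          one_mul]
      · intro l hl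
        rw [Real.smoothTransition.deriv_eq_zero_of_one_le
          (by linarith [h.1 l (Finset.mem_range.1 hl)])]
        simp
    have e2 : fderiv ℝ (frozenSum N b τ m) x v - v = -b.tail m v := by
      rw [e, b.tail_apply]; abel
    rw [e2, map_neg, b.tail_tail le_rfl]
  | succ j hj ih =>
    rw [hτ.fderiv_frozenSum_succ_apply hN hC, add_sub_right_comm, map_add, ih, map_smul,
      b.tail_basis_of_le hj]

end IsFirstDominated

theorem IsRadiusFamily.abs_fderiv_radiusRatio_le (hτ : IsRadiusFamily N L τ)
    (hb : IsOneSuppressionUnconditional N b)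
    (hN : IsEquivalentNorm N) (hC : IsC1Norm N) (k : ℕ) (x v : E) :
    |fderiv ℝ (radiusRatio N b τ k) x v| ≤
      (L * N (fderiv ℝ (frozenSum N b τ k) x v) + radiusRatio N b τ k x * N v)
        / tailSize N b k x := by
  rw [hτ.fderiv_radiusRatio_apply hN hC, abs_div, abs_of_pos (tailSize_pos k x)]
  refine div_le_div_of_nonneg_right ?_ (tailSize_pos k x).le
  refine (abs_sub _ _).trans (add_le_add (hτ.abs_fderiv_le _ _ _) ?_)
  rw [abs_mul, abs_of_nonneg (hτ.radiusRatio_nonneg _ _)]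
  exact mul_le_mul_of_nonneg_left ((abs_fderiv_tailSize_le hN hC k x v).trans (hb.tail_le k v))
    (hτ.radiusRatio_nonneg _ _)

/-- The derivative of the ratio involves earlier differentials only through the factor L. With 16cL
≤ 1 the bound 2 + 32c reproduces itself under induction. -/
theorem IsFirstDominated.fderiv_frozenSum_le {m : ℕ} {x : E} (h : IsFirstDominated N b τ m x)
    (hτ : IsRadiusFamily N L τ) (hb : IsOneSuppressionUnconditional N b)
    (hN : IsEquivalentNorm N) (hC : IsC1Norm N) {c : ℝ} (hc1 : 1 ≤ c)
    (hc : ∀ s, |deriv Real.smoothTransition s| ≤ c) (hL0 : 0 ≤ L) (hL : 16 * c * L ≤ 1)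
    (j : ℕ) (v : E) :
    N (fderiv ℝ (frozenSum N b τ j) x v) ≤ (2 + 32 * c) * N v := by
  have hL2 : L ≤ 1 / 2 := by nlinarith
  induction j using Nat.strong_induction_on with
  | _ j ih =>
  have hv := apply_nonneg N v
  have ht := tailSize_pos (N := N) (b := b) m x
  rw [hτ.fderiv_frozenSum_apply hN hC]
  have h1 := hb.sum_le hN (Finset.range j)
    (fun l => Real.smoothTransition (2 - radiusRatio N b τ l x))
    (fun l _ => Real.smoothTransition.nonneg _) (fun l _ => Real.smoothTransition.le_one _) v
  -- The multipliers from differentiating the step vanish before m and for ratios at least 2; in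
  -- between they are O(N v / T_m). The remaining factor N of the m-th tail of x cancels T_m.
  have h2 := hb.sum_tail_le_of_eq_zero hN (Finset.range j)
    (fun l => -(deriv Real.smoothTransition (2 - radiusRatio N b τ l x) *
          fderiv ℝ (radiusRatio N b τ l) x v)) (k := m)
    (M := c * ((L * (2 + 32 * c) + 2) * N v * 4 / tailSize N b m x)) (by
      intro l _ hl
      rw [Real.smoothTransition.deriv_eq_zero_of_one_le (by linarith [h.1 l hl])]
      simp) (by positivity) (by
      intro l hl hml
      rw [abs_neg, abs_mul]
      rcases le_or_gt 2 (radiusRatio N b τ l x) with h2 | h2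
      · rw [Real.smoothTransition.deriv_eq_zero_of_nonpos (by linarith), abs_zero, zero_mul]
        positivity
      · refine mul_le_mul (hc _) ?_ (abs_nonneg _) (by linarith)
        refine (hτ.abs_fderiv_radiusRatio_le hb hN hC l x v).trans ?_
        have h3 := h.tailSize_le_mul hτ hb hN hL2 hml h2.le
        have h4 := ih l (Finset.mem_range.1 hl)
        have h5 := mul_le_mul_of_nonneg_left h4 hL0
        have h6 := mul_le_mul_of_nonneg_right h2.le hv
        rw [div_le_div_iff₀ (tailSize_pos l x) ht]
        calc _ ≤ ((L * (2 + 32 * c) + 2) * N v) * (2 * 2 * tailSize N b l x) := by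
              refine mul_le_mul ?_ h3 ht.le (by positivity)
              linarith
          _ = _ := by ring) x
  refine (map_add_le_add N _ _).trans ((add_le_add h1 h2).trans ?_)
  have h3 : 2 * (c * ((L * (2 + 32 * c) + 2) * N v * 4 / tailSize N b m x)) * N (b.tail m x)
      ≤ 2 * (c * ((L * (2 + 32 * c) + 2) * N v * 4 / tailSize N b m x)) * tailSize N b m x :=
    mul_le_mul_of_nonneg_left (seminorm_tail_le_tailSize m x) (by positivity)
  refine (add_le_add le_rfl h3).trans ?_
  have e : 2 * (c * ((L * (2 + 32 * c) + 2) * N v * 4 / tailSize N b m x)) * tailSize N b m x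
      = (16 * c * L * (1 + 16 * c) + 16 * c) * N v := by
    field_simp; ring
  rw [e]
  have : 16 * c * L * (1 + 16 * c) ≤ 1 * (1 + 16 * c) :=
    mul_le_mul_of_nonneg_right hL (by linarith)
  nlinarith

end Freezing

/-! ### The gated perturbation and its size -/

section Perturbation

theorem HasSum.norm_le_of_le_geometric {F : Type*} [NormedAddCommGroup F] {u : ℕ → F} {a : F}
    (h : HasSum u a) {A : ℝ} (hA : ∀ j, ‖u j‖ ≤ A * (1 / 2 : ℝ) ^ j) : ‖a‖ ≤ A * 2 :=
  h.norm_le_of_bounded (hasSum_geometric_two.mul_left A) hA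

/-- Merging the finite correction into the series gives one series with gated coefficients, which
can be bounded term by term. -/
theorem hasSum_sub_sum_range {F : Type*} [NormedAddCommGroup F] {u a : ℕ → F} {s : F}
    (h : HasSum u s) (K : ℕ) :
    HasSum (fun j => u j - if j < K then a j else 0) (s - ∑ j ∈ Finset.range K, a j) := by
  refine h.sub ?_
  have := hasSum_sum_of_ne_finset_zero (L := SummationFilter.unconditional ℕ)
    (f := fun j => if j < K then a j else 0)
    (s := Finset.range K) (fun j hj => by simpa using fun h => absurd h (by simpa using hj))
  convert this using 1
  refine Finset.sum_congr rfl fun j hj => ?_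
  rw [if_pos (Finset.mem_range.1 hj)]

variable {E : Type*} [NormedAddCommGroup E] [NormedSpace ℝ E] {N : Seminorm ℝ E}
  {b : SchauderBasis ℝ E} {L : ℝ} {τ : ℕ → E → ℝ}
  {F : Type*} [NormedAddCommGroup F] [NormedSpace ℝ F] {w : ℕ → F} {δ : ℝ}

/-- Rapidly decreasing weights for the coordinates of the basis `b`. -/
noncomputable def coordWeight (N : Seminorm ℝ E) (b : SchauderBasis ℝ E) (δ : ℝ) (j : ℕ) : ℝ :=
  δ * (1 / 8) ^ j * N (b j)

/-- The operator `x ↦ ∑ δ_j x_j w_j` with the weights `δ_j = coordWeight N b δ j`. -/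
noncomputable def weightedMap (N : Seminorm ℝ E) (b : SchauderBasis ℝ E) (δ : ℝ) (w : ℕ → F) :
    E →L[ℝ] F :=
  ∑' j, (coordWeight N b δ j • b.coord j).smulRight (w j)

theorem IsOneSuppressionUnconditional.abs_coordWeight_mul_le
    (hb : IsOneSuppressionUnconditional N b) (hN : IsEquivalentNorm N) (hδ : 0 ≤ δ) {j k : ℕ}
    (h : k ≤ j) (x : E) :
    |coordWeight N b δ j * b.coord j x| ≤ δ * (1 / 8) ^ j * N (b.tail k x) := by
  have h1 := hb.coord_smul_le hN h x
  rw [coordWeight, abs_mul, abs_of_nonneg (by positivity)]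
  calc _ = δ * (1 / 8) ^ j * (|b.coord j x| * N (b j)) := by ring
    _ ≤ _ := mul_le_mul_of_nonneg_left h1 (by positivity)

theorem coordWeight_pos (hN : IsEquivalentNorm N) (hδ : 0 < δ) (j : ℕ) :
    0 < coordWeight N b δ j := by
  have hb0 : b j ≠ 0 := by
    intro h; have := b.coord_self j; rw [h, map_zero] at this; exact zero_ne_one this
  have := hN.pos hb0
  rw [coordWeight]; positivity

theorem hasSum_weightedMap [CompleteSpace F] (hb : IsOneSuppressionUnconditional N b)
    (hN : IsEquivalentNorm N) (hδ : 0 ≤ δ) (hw : ∀ j, ‖w j‖ ≤ 1) (x : E) :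
    HasSum (fun j => (coordWeight N b δ j * b.coord j x) • w j) (weightedMap N b δ w x) := by
  have hN' := hN
  obtain ⟨c, C, hc, hC0, h⟩ := hN
  have hs : Summable fun j => (coordWeight N b δ j • b.coord j).smulRight (w j) := by
    refine Summable.of_norm_bounded (g := fun j => δ * C * (1 / 8 : ℝ) ^ j)
      ((summable_geometric_of_lt_one (by norm_num) (by norm_num)).mul_left _) fun j => ?_
    refine ContinuousLinearMap.opNorm_le_bound _ (by positivity) fun v => ?_
    rw [ContinuousLinearMap.smulRight_apply, norm_smul, smul_apply, smul_eq_mul]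
    have h1 := hb.abs_coordWeight_mul_le hN' hδ j.zero_le v
    have h2 := (hb.tail_le 0 v).trans (h v).2
    calc _ ≤ (δ * (1 / 8) ^ j * (C * ‖v‖)) * 1 := by
          refine mul_le_mul (h1.trans (mul_le_mul_of_nonneg_left h2 (by positivity))) (hw j)
            (norm_nonneg _) (by positivity)
      _ = _ := by ring
  have h1 := (ContinuousLinearMap.apply ℝ F x).hasSum hs.hasSum
  exact h1

theorem weightedMap_basis [CompleteSpace F] (hb : IsOneSuppressionUnconditional N b)
    (hN : IsEquivalentNorm N) (hδ : 0 ≤ δ) (hw : ∀ j, ‖w j‖ ≤ 1) (j : ℕ) :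
    weightedMap N b δ w (b j) = coordWeight N b δ j • w j := by
  refine (hasSum_weightedMap hb hN hδ hw (b j)).unique ?_
  have := hasSum_single (f := fun l => (coordWeight N b δ l * b.coord l (b j)) • w l) j
    (fun l hl => by simp [b.ortho, hl])
  simpa [b.ortho] using this

/-- A smooth gate that opens when the radius ratio crosses a window that shrinks to `8`. -/
noncomputable def gate (N : Seminorm ℝ E) (b : SchauderBasis ℝ E) (τ : ℕ → E → ℝ) (j : ℕ)
    (x : E) : ℝ :=
  Real.smoothTransition (2 ^ j * (radiusRatio N b τ j x - 8) - 1)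

/-- The derivative of the gate with respect to the radius ratio. -/
noncomputable def gateSlope (N : Seminorm ℝ E) (b : SchauderBasis ℝ E) (τ : ℕ → E → ℝ) (j : ℕ)
    (x : E) : ℝ :=
  deriv Real.smoothTransition (2 ^ j * (radiusRatio N b τ j x - 8) - 1) * 2 ^ j

theorem gate_eq_zero {j : ℕ} {x : E} (h : radiusRatio N b τ j x ≤ 8) : gate N b τ j x = 0 := by
  refine Real.smoothTransition.zero_of_nonpos ?_
  have : 2 ^ j * (radiusRatio N b τ j x - 8) ≤ 0 :=
    mul_nonpos_of_nonneg_of_nonpos (by positivity) (by linarith)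
  linarith

theorem gateSlope_eq_zero {j : ℕ} {x : E} (h : radiusRatio N b τ j x ≤ 8) :
    gateSlope N b τ j x = 0 := by
  have : 2 ^ j * (radiusRatio N b τ j x - 8) ≤ 0 :=
    mul_nonpos_of_nonneg_of_nonpos (by positivity) (by linarith)
  rw [gateSlope, Real.smoothTransition.deriv_eq_zero_of_nonpos (by linarith), zero_mul]

theorem two_le_pow_mul {j : ℕ} {r : ℝ} (h : 10 ≤ r) : 2 ≤ (2 : ℝ) ^ j * (r - 8) := by
  have h1 : (1 : ℝ) ≤ 2 ^ j := one_le_pow₀ (by norm_num)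
  nlinarith

theorem gate_eq_one {j : ℕ} {x : E} (h : 10 ≤ radiusRatio N b τ j x) : gate N b τ j x = 1 :=
  Real.smoothTransition.one_of_one_le (by linarith [two_le_pow_mul (j := j) h])

theorem gate_mem (j : ℕ) (x : E) : |gate N b τ j x| ≤ 1 := by
  rw [gate, abs_of_nonneg (Real.smoothTransition.nonneg _)]
  exact Real.smoothTransition.le_one _

theorem window_of_gateSlope_ne_zero {j : ℕ} {x : E} (h : gateSlope N b τ j x ≠ 0) :
    1 < 2 ^ j * (radiusRatio N b τ j x - 8) ∧ 2 ^ j * (radiusRatio N b τ j x - 8) < 2 := by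
  constructor
  · by_contra! h1
    exact h (by rw [gateSlope, Real.smoothTransition.deriv_eq_zero_of_nonpos (by linarith),
      zero_mul])
  · by_contra! h1
    exact h (by rw [gateSlope, Real.smoothTransition.deriv_eq_zero_of_one_le (by linarith),
      zero_mul])

theorem radiusRatio_of_gateSlope_ne_zero {j : ℕ} {x : E} (h : gateSlope N b τ j x ≠ 0) :
    8 < radiusRatio N b τ j x ∧ radiusRatio N b τ j x < 10 := by
  constructor
  · by_contra! h1
    exact h (gateSlope_eq_zero h1)
  · by_contra! h1
    linarith [two_le_pow_mul (j := j) h1, (window_of_gateSlope_ne_zero h).2]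

/-- At most one gate is moving at a given point. -/
theorem IsRadiusFamily.eq_of_gateSlope_ne_zero (hτ : IsRadiusFamily N L τ)
    (hb : IsOneSuppressionUnconditional N b) {j l : ℕ} {x : E} (hj : gateSlope N b τ j x ≠ 0)
    (hl : gateSlope N b τ l x ≠ 0) : j = l := by
  have key : ∀ i k : ℕ, i < k → gateSlope N b τ i x ≠ 0 → gateSlope N b τ k x ≠ 0 → False := by
    intro i k hik hi hk
    have h1 := (window_of_gateSlope_ne_zero hi).1
    have h2 := (window_of_gateSlope_ne_zero hk).2
    have h8 := (radiusRatio_of_gateSlope_ne_zero hi).1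
    have h3 := hτ.radiusRatio_mono hb hik.le (by linarith : 2 ≤ radiusRatio N b τ i x)
    -- The window of gate j is 8 + 2^(-j) to 8 + 2·2^(-j). Since the ratio increases with the index,
    -- a ratio inside window i puts the ratio at k > i beyond window k.
    have h4 : (2 : ℝ) ^ i * 2 ≤ 2 ^ k := by
      rw [← pow_succ]
      exact pow_le_pow_right₀ (by norm_num) hik
    have h5 := mul_le_mul h4 (sub_le_sub_right h3 8) (by linarith) (by positivity)
    linarith
  rcases lt_trichotomy j l with h | h | h
  · exact (key j l h hj hl).elim
  · exact h
  · exact (key l j h hl hj).elim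

theorem IsRadiusFamily.contDiff_gate (hτ : IsRadiusFamily N L τ)
    (hN : IsEquivalentNorm N) (hC : IsC1Norm N) (j : ℕ) : ContDiff ℝ 1 (gate N b τ j) :=
  Real.smoothTransition.contDiff.comp
    ((contDiff_const.mul ((hτ.contDiff_radiusRatio hN hC j).sub contDiff_const)).sub
      contDiff_const)

theorem IsRadiusFamily.hasFDerivAt_gate (hτ : IsRadiusFamily N L τ)
    (hN : IsEquivalentNorm N) (hC : IsC1Norm N) (j : ℕ) (x : E) :
    HasFDerivAt (gate N b τ j) (gateSlope N b τ j x • fderiv ℝ (radiusRatio N b τ j) x) x := by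
  have h := (Real.smoothTransition.hasDerivAt
    (2 ^ j * (radiusRatio N b τ j x - 8) - 1)).comp_hasFDerivAt x
    ((((hτ.hasFDerivAt_radiusRatio (b := b) hN hC j x).sub_const 8).const_mul
      ((2 : ℝ) ^ j)).sub_const 1)
  rw [gateSlope, mul_smul]
  exact h

/-- The weighted map with the coordinates of index less than `K` gated. -/
noncomputable def gatedMap (N : Seminorm ℝ E) (b : SchauderBasis ℝ E) (τ : ℕ → E → ℝ) (δ : ℝ)
    (w : ℕ → F) (K : ℕ) (x : E) : F :=
  weightedMap N b δ w x -
    ∑ j ∈ Finset.range K, ((1 - gate N b τ j x) * (coordWeight N b δ j * b.coord j x)) • w j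

theorem IsRadiusFamily.gatedMap_eq (hτ : IsRadiusFamily N L τ)
    (hb : IsOneSuppressionUnconditional N b) {K K' : ℕ} (h : K ≤ K') {x : E}
    (hx : 10 < radiusRatio N b τ K x) : gatedMap N b τ δ w K' x = gatedMap N b τ δ w K x := by
  rw [gatedMap, gatedMap, ← Finset.sum_range_add_sum_Ico _ h,
    Finset.sum_eq_zero (s := Finset.Ico K K'), add_zero]
  intro j hj
  have := hτ.radiusRatio_mono hb (Finset.mem_Ico.1 hj).1 (by linarith : 2 ≤ radiusRatio N b τ K x)
  rw [gate_eq_one (by linarith)]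
  simp

theorem IsRadiusFamily.contDiff_gatedMap (hτ : IsRadiusFamily N L τ)
    (hN : IsEquivalentNorm N) (hC : IsC1Norm N) (K : ℕ) :
    ContDiff ℝ 1 (gatedMap N b τ δ w K) := by
  refine (weightedMap N b δ w).contDiff.sub (ContDiff.sum fun j _ => ?_)
  exact ((contDiff_const.sub (hτ.contDiff_gate hN hC j)).mul
    (contDiff_const.mul (b.coord j).contDiff)).smul contDiff_const

theorem IsRadiusFamily.fderiv_gatedMap_apply (hτ : IsRadiusFamily N L τ)
    (hN : IsEquivalentNorm N) (hC : IsC1Norm N) (K : ℕ) (x v : E) :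
    fderiv ℝ (gatedMap N b τ δ w K) x v = weightedMap N b δ w v -
      ∑ j ∈ Finset.range K, ((1 - gate N b τ j x) * (coordWeight N b δ j * b.coord j v)
        - gateSlope N b τ j x * fderiv ℝ (radiusRatio N b τ j) x v *
          (coordWeight N b δ j * b.coord j x)) • w j := by
  have h : HasFDerivAt (gatedMap N b τ δ w K) _ x :=
    (weightedMap N b δ w).hasFDerivAt.sub (HasFDerivAt.fun_sum (u := Finset.range K) fun j _ =>
      (((hτ.hasFDerivAt_gate (b := b) hN hC j x).const_sub 1).mul
        ((b.coord j).hasFDerivAt.const_mul (coordWeight N b δ j))).smul_const (w j))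
  rw [h.fderiv]
  simp only [sub_apply, add_apply, smul_apply, smul_eq_mul, neg_apply,
    ContinuousLinearMap.smulRight_apply, sum_apply]
  congr 1
  refine Finset.sum_congr rfl fun j _ => ?_
  congr 1
  ring

theorem IsFirstDominated.norm_gatedMap_le [CompleteSpace F] {m : ℕ} {x : E}
    (h : IsFirstDominated N b τ m x) (hb : IsOneSuppressionUnconditional N b)
    (hN : IsEquivalentNorm N) (hδ : 0 ≤ δ) (hw : ∀ j, ‖w j‖ ≤ 1) {K : ℕ} (hK : m ≤ K) :
    ‖gatedMap N b τ δ w K x‖ ≤ δ * N (b.tail m x) * 2 := by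
  refine (hasSum_sub_sum_range (hasSum_weightedMap hb hN hδ hw x) K).norm_le_of_le_geometric
    fun j => ?_
  have e : (coordWeight N b δ j * b.coord j x) • w j - (if j < K then
      ((1 - gate N b τ j x) * (coordWeight N b δ j * b.coord j x)) • w j else 0) =
      ((if j < K then gate N b τ j x else 1) * (coordWeight N b δ j * b.coord j x)) • w j := by
    split_ifs <;> module
  rw [e, norm_smul, Real.norm_eq_abs, abs_mul]
  rcases lt_or_ge j m with hj | hj
  · rw [if_pos (hj.trans_le hK), gate_eq_zero (by linarith [h.1 j hj])]
    simp only [abs_zero, zero_mul]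
    positivity
  · have h1 : |if j < K then gate N b τ j x else 1| ≤ 1 := by
      split_ifs
      · exact gate_mem j x
      · simp
    have h2 := hb.abs_coordWeight_mul_le hN hδ hj x
    have h3 : (1 / 8 : ℝ) ^ j ≤ (1 / 2) ^ j :=
      pow_le_pow_left₀ (by norm_num) (by norm_num) j
    calc _ ≤ 1 * (δ * (1 / 8) ^ j * N (b.tail m x)) * 1 := by
          refine mul_le_mul (mul_le_mul h1 h2 (abs_nonneg _) zero_le_one) (hw j) (norm_nonneg _) ?_
          positivity
      _ = δ * N (b.tail m x) * (1 / 8) ^ j := by ring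
      _ ≤ _ := mul_le_mul_of_nonneg_left h3 (by positivity)

/-- The slope of a gate costs 2^j, which turns the weight (1/8)^j into (1/4)^j. Half of that sums
the series; the other half yields (1/2)^m, which the local radius will dominate. -/
theorem IsFirstDominated.norm_fderiv_gatedMap_le [CompleteSpace F] {m : ℕ} {x : E}
    (h : IsFirstDominated N b τ m x) (hτ : IsRadiusFamily N L τ)
    (hb : IsOneSuppressionUnconditional N b)
    (hN : IsEquivalentNorm N) (hC : IsC1Norm N) {c : ℝ} (hc1 : 1 ≤ c)
    (hc : ∀ s, |deriv Real.smoothTransition s| ≤ c) (hL0 : 0 ≤ L) (hL : 16 * c * L ≤ 1)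
    (hδ : 0 ≤ δ) (hw : ∀ j, ‖w j‖ ≤ 1) {K : ℕ} (hK : m ≤ K) (v : E) :
    ‖fderiv ℝ (gatedMap N b τ δ w K) x v‖
      ≤ δ * (1 + c * (L * (2 + 32 * c) + 10) * 20) * (1 / 2) ^ m * N v * 2 := by
  have hL2 : L ≤ 1 / 2 := by nlinarith
  have ht := tailSize_pos (N := N) (b := b) m x
  have hv := apply_nonneg N v
  rw [hτ.fderiv_gatedMap_apply hN hC]
  refine (hasSum_sub_sum_range (hasSum_weightedMap hb hN hδ hw v) K).norm_le_of_le_geometric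
    fun j => ?_
  have e : (coordWeight N b δ j * b.coord j v) • w j - (if j < K then
      ((1 - gate N b τ j x) * (coordWeight N b δ j * b.coord j v)
        - gateSlope N b τ j x * fderiv ℝ (radiusRatio N b τ j) x v *
          (coordWeight N b δ j * b.coord j x)) • w j else 0) =
      ((if j < K then gate N b τ j x else 1) * (coordWeight N b δ j * b.coord j v)
        + (if j < K then gateSlope N b τ j x else 0) * fderiv ℝ (radiusRatio N b τ j) x v *
          (coordWeight N b δ j * b.coord j x)) • w j := by
    split_ifs <;> module
  rw [e, norm_smul, Real.norm_eq_abs]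
  rcases lt_or_ge j m with hj | hj
  · rw [if_pos (hj.trans_le hK), gate_eq_zero (by linarith [h.1 j hj]),
      if_pos (hj.trans_le hK), gateSlope_eq_zero (by linarith [h.1 j hj])]
    simp only [zero_mul, add_zero, abs_zero]
    positivity
  · have h1 : |if j < K then gate N b τ j x else 1| ≤ 1 := by
      split_ifs
      · exact gate_mem j x
      · simp
    have h2 := (hb.abs_coordWeight_mul_le hN hδ hj v).trans
      (mul_le_mul_of_nonneg_left (hb.tail_le m v) (by positivity))
    have h3 := (hb.abs_coordWeight_mul_le hN hδ hj x).trans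
      (mul_le_mul_of_nonneg_left (seminorm_tail_le_tailSize m x) (by positivity))
    have h4 : |(if j < K then gateSlope N b τ j x else 0) * fderiv ℝ (radiusRatio N b τ j) x v *
        (coordWeight N b δ j * b.coord j x)|
        ≤ δ * (c * (L * (2 + 32 * c) + 10) * 20) * (1 / 4) ^ j * N v := by
      by_cases hs : gateSlope N b τ j x = 0
      · rw [hs]
        simp only [ite_self, zero_mul, abs_zero]
        positivity
      have hr := (radiusRatio_of_gateSlope_ne_zero hs).2.le
      have h5 : |if j < K then gateSlope N b τ j x else 0| ≤ c * 2 ^ j := by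
        split_ifs
        · rw [gateSlope, abs_mul, abs_of_nonneg (a := (2 : ℝ) ^ j) (by positivity)]
          exact mul_le_mul_of_nonneg_right (hc _) (by positivity)
        · simp only [abs_zero]; positivity
      have h6 : |fderiv ℝ (radiusRatio N b τ j) x v| ≤
          ((L * (2 + 32 * c) + 10) * N v) * 20 / tailSize N b m x := by
        refine (hτ.abs_fderiv_radiusRatio_le hb hN hC j x v).trans ?_
        have h7 := mul_le_mul_of_nonneg_left
          (h.fderiv_frozenSum_le hτ hb hN hC hc1 hc hL0 hL j v) hL0
        have h8 := mul_le_mul_of_nonneg_right hr hv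
        have h9 := h.tailSize_le_mul hτ hb hN hL2 hj hr
        rw [div_le_div_iff₀ (tailSize_pos j x) ht]
        calc _ ≤ ((L * (2 + 32 * c) + 10) * N v) * (2 * 10 * tailSize N b j x) := by
              refine mul_le_mul ?_ h9 ht.le (by positivity)
              linarith
          _ = _ := by ring
      rw [abs_mul, abs_mul]
      have e8 : (1 / 4 : ℝ) ^ j = 2 ^ j * (1 / 8) ^ j := by
        rw [← mul_pow]; norm_num
      calc _ ≤ (c * 2 ^ j) * (((L * (2 + 32 * c) + 10) * N v) * 20 / tailSize N b m x)
            * (δ * (1 / 8) ^ j * tailSize N b m x) := by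
            refine mul_le_mul (mul_le_mul h5 h6 (abs_nonneg _) (by positivity)) h3
              (abs_nonneg _) (by positivity)
        _ = _ := by
            rw [e8]; field_simp
    have h5 : |(if j < K then gate N b τ j x else 1) * (coordWeight N b δ j * b.coord j v)|
        ≤ δ * (1 / 4) ^ j * N v := by
      rw [abs_mul]
      have h6 : (1 / 8 : ℝ) ^ j ≤ (1 / 4) ^ j :=
        pow_le_pow_left₀ (by norm_num) (by norm_num) j
      calc _ ≤ 1 * (δ * (1 / 8) ^ j * N v) := mul_le_mul h1 h2 (abs_nonneg _) zero_le_one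
        _ = (1 / 8) ^ j * (δ * N v) := by ring
        _ ≤ (1 / 4) ^ j * (δ * N v) := mul_le_mul_of_nonneg_right h6 (by positivity)
        _ = _ := by ring
    have h6 : (1 / 4 : ℝ) ^ j ≤ (1 / 2) ^ m * (1 / 2) ^ j := by
      have : (1 / 4 : ℝ) ^ j = (1 / 2) ^ j * (1 / 2) ^ j := by rw [← mul_pow]; norm_num
      rw [this]
      exact mul_le_mul_of_nonneg_right
        (pow_le_pow_of_le_one (by norm_num) (by norm_num) hj) (by positivity)
    calc _ ≤ (δ * (1 / 4) ^ j * N v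
          + δ * (c * (L * (2 + 32 * c) + 10) * 20) * (1 / 4) ^ j * N v) * 1 := by
          refine mul_le_mul ((abs_add_le _ _).trans (add_le_add h5 h4)) (hw j) (norm_nonneg _) ?_
          positivity
      _ = (δ * (1 + c * (L * (2 + 32 * c) + 10) * 20) * N v) * (1 / 4) ^ j := by ring
      _ ≤ (δ * (1 + c * (L * (2 + 32 * c) + 10) * 20) * N v) * ((1 / 2) ^ m * (1 / 2) ^ j) :=
          mul_le_mul_of_nonneg_left h6 (by positivity)
      _ = _ := by ring

end Perturbation

/-! ### Subspaces given by vanishing coordinates -/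

section CoordinateSubspace

variable {E : Type*} [NormedAddCommGroup E] [NormedSpace ℝ E] {N : Seminorm ℝ E}
  {b : SchauderBasis ℝ E} {A : Set ℕ}

/-- The subspace of the vectors whose coordinates with index in `A` vanish. -/
def coordSubspace (b : SchauderBasis ℝ E) (A : Set ℕ) : Submodule ℝ E where
  carrier := {x | ∀ j ∈ A, b.coord j x = 0}
  add_mem' hx hy j hj := by rw [map_add, hx j hj, hy j hj, add_zero]
  zero_mem' j _ := map_zero _
  smul_mem' c x hx j hj := by rw [map_smul, hx j hj, smul_zero]

theorem mem_coordSubspace {x : E} : x ∈ coordSubspace b A ↔ ∀ j ∈ A, b.coord j x = 0 := Iff.rfl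

theorem not_finiteDimensional_quotient_coordSubspace (hA : A.Infinite) :
    ¬ FiniteDimensional ℝ (E ⧸ coordSubspace b A) := by
  intro hfin
  have hli : LinearIndependent ℝ fun j : A => (coordSubspace b A).mkQ (b j) := by
    refine LinearIndependent.of_pairwise_dual_eq_zero_one _
      (fun j => (coordSubspace b A).liftQ (b.coord j : E →ₗ[ℝ] ℝ)
        fun x hx => LinearMap.mem_ker.2 (mem_coordSubspace.1 hx j j.2)) (fun i j hij => ?_)
      fun i => ?_
    · exact b.coord_of_ne fun h => hij (Subtype.ext h)
    · exact b.coord_self i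
  exact hA (Set.finite_coe_iff.1 hli.finite)

/-- Unconditionality makes the expansion restricted to A converge; its sum P x is a bounded operator
by Banach–Steinhaus, and id - P is the projection sought. -/
theorem closedComplemented_coordSubspace [CompleteSpace E]
    (hb : IsOneSuppressionUnconditional N b) (hN : IsEquivalentNorm N) :
    (coordSubspace b A).ClosedComplemented := by
  classical
  let p : ℕ → E →L[ℝ] E := fun n =>
    ∑ j ∈ Finset.range n with j ∈ A, (b.coord j).smulRight (b j)
  have hp : ∀ n x, p n x = ∑ j ∈ Finset.range n with j ∈ A, b.coord j x • b j := by
    intro n x; simp [p]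
  have hcauchy : ∀ x, CauchySeq fun n => p n x := by
    intro x
    obtain ⟨c, C, hc, hC0, h⟩ := hN
    have hN : IsEquivalentNorm N := ⟨c, C, hc, hC0, h⟩
    refine cauchySeq_of_le_tendsto_0' (fun n => N (b.tail n x) / c) (fun n m hnm => ?_) ?_
    · rw [dist_eq_norm, norm_sub_rev, le_div_iff₀ hc, mul_comm]
      refine (h _).1.trans ?_
      have e : p m x - p n x = ∑ j ∈ Finset.Ico n m with j ∈ A, (1 * b.coord j x) • b j := by
        rw [hp, hp, Finset.sum_filter, Finset.sum_filter, Finset.sum_filter,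
          ← Finset.sum_range_add_sum_Ico _ hnm]
        simp
      rw [e]
      exact hb.sum_tail_le hN _ (fun _ => 1)
        (fun l hl => (Finset.mem_Ico.1 (Finset.mem_filter.1 hl).1).1) (by simp) (by simp) x
    · have := ((hN.continuous.tendsto 0).comp (b.tendsto_tail x)).div_const c
      rw [map_zero, zero_div] at this
      exact this
  choose q hq using fun x => cauchySeq_tendsto_of_complete (hcauchy x)
  let P : E →L[ℝ] E := continuousLinearMapOfTendsto p (tendsto_pi_nhds.2 hq)
  have hP : ∀ x, Tendsto (fun n => p n x) atTop (𝓝 (P x)) := hq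
  have hcoord : ∀ x, ∀ j ∈ A, b.coord j (P x) = b.coord j x := by
    intro x j hj
    refine tendsto_nhds_unique (((b.coord j).continuous.tendsto _).comp (hP x)) ?_
    refine tendsto_const_nhds.congr' (eventually_atTop.2 ⟨j + 1, fun n hn => ?_⟩)
    rw [Function.comp_apply, hp, b.coord_sum, if_pos]
    simp only [Finset.mem_filter, Finset.mem_range]
    exact ⟨by omega, hj⟩
  refine ⟨(ContinuousLinearMap.id ℝ E - P).codRestrict (coordSubspace b A) fun x j hj => ?_,
    fun x => ?_⟩
  · rw [sub_apply, ContinuousLinearMap.id_apply, map_sub, hcoord x j hj, sub_self]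
  · have h0 : P x = 0 := by
      refine tendsto_nhds_unique (hP x) (tendsto_const_nhds.congr fun n => ?_)
      rw [hp, Finset.sum_eq_zero]
      intro j hj
      rw [mem_coordSubspace.1 x.2 j (Finset.mem_filter.1 hj).2, zero_smul]
    refine Subtype.ext ?_
    change (x : E) - P x = x
    rw [h0, sub_zero]

end CoordinateSubspace

/-! ### Coordinates that vanish at a critical point -/

section Critical

variable {E : Type*} [NormedAddCommGroup E] [NormedSpace ℝ E] {N : Seminorm ℝ E}
  {b : SchauderBasis ℝ E} {L : ℝ} {τ : ℕ → E → ℝ}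
  {F : Type*} [NormedAddCommGroup F] [NormedSpace ℝ F] {w : ℕ → F} {δ : ℝ}

/-- In use, φ annihilates the range of the derivative and α is φ composed with the derivative of f
at the frozen sum. Testing on early basis vectors removes the frozen part; testing on late ones
isolates the single moving gate. -/
theorem IsRadiusFamily.coord_eq_zero_of_critical [CompleteSpace F] (hτ : IsRadiusFamily N L τ)
    (hb : IsOneSuppressionUnconditional N b) (hN : IsEquivalentNorm N) (hC : IsC1Norm N)
    (hS : IsStrictlyConvexNorm N) (hδ : 0 < δ) (hw : ∀ j, ‖w j‖ ≤ 1) {K : ℕ} {x : E}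
    (hK : 10 < radiusRatio N b τ K x) {α : E →L[ℝ] ℝ} {φ : F →L[ℝ] ℝ}
    (h0 : ∀ v, α (fderiv ℝ (frozenSum N b τ K) x v)
      + φ (fderiv ℝ (gatedMap N b τ δ w K) x v) = 0)
    {i : ℕ} (hi : K ≤ i) (hφ : φ (w i) ≠ 0) {j : ℕ} (hj : K ≤ j) (hwj : w j = 0) :
    b.coord j x = 0 := by
  classical
  have hex : ∃ k, 2 ≤ radiusRatio N b τ k x := ⟨K, by linarith⟩
  obtain ⟨m, hm2, hmin⟩ : ∃ m, 2 ≤ radiusRatio N b τ m x ∧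
      ∀ l < m, radiusRatio N b τ l x < 2 :=
    ⟨Nat.find hex, Nat.find_spec hex, fun l hl => not_le.1 (Nat.find_min hex hl)⟩
  have hle : ∀ l, 2 ≤ radiusRatio N b τ l x → m ≤ l := fun l hl => by
    by_contra! h; exact absurd (hmin l h) (not_lt.2 hl)
  have hmK : m ≤ K := hle K (by linarith)
  have hslope : ∀ l, gateSlope N b τ l x ≠ 0 → m ≤ l := fun l hl =>
    hle l (by linarith [(radiusRatio_of_gateSlope_ne_zero hl).1])
  set κ : ℕ → ℝ := fun l => gateSlope N b τ l x *
    (coordWeight N b δ l * b.coord l x * φ (w l)) / tailSize N b l x with hκ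
  have hκ0 : ∀ l, gateSlope N b τ l x = 0 → κ l = 0 := fun l hl => by simp [hκ, hl]
  -- Moving gates have index at least m, where the sums are already frozen, so the part of their
  -- derivative coming from the radius also factors through the m-th differential and joins α.
  set β : E →L[ℝ] ℝ := α + ∑ l ∈ Finset.range K, κ l • fderiv ℝ (τ l) (frozenSum N b τ l x)
    with hβ
  have rel : ∀ v, β (fderiv ℝ (frozenSum N b τ m) x v) + φ (weightedMap N b δ w v)
      - ∑ l ∈ Finset.range K, (1 - gate N b τ l x) * (coordWeight N b δ l * b.coord l v) * φ (w l)
      - ∑ l ∈ Finset.range K, κ l * (radiusRatio N b τ l x * fderiv ℝ (tailSize N b l) x v)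
      = 0 := by
    intro v
    rw [← h0 v, hτ.fderiv_frozenSum_eq hb hN hC hmK hm2, hτ.fderiv_gatedMap_apply hN hC, hβ,
      map_sub, map_sum, add_apply, sum_apply]
    have e : ∑ l ∈ Finset.range K, φ (((1 - gate N b τ l x) * (coordWeight N b δ l * b.coord l v)
          - gateSlope N b τ l x * fderiv ℝ (radiusRatio N b τ l) x v *
          (coordWeight N b δ l * b.coord l x)) • w l)
        = ∑ l ∈ Finset.range K,
            (1 - gate N b τ l x) * (coordWeight N b δ l * b.coord l v) * φ (w l)
          + ∑ l ∈ Finset.range K, κ l * (radiusRatio N b τ l x * fderiv ℝ (tailSize N b l) x v)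
          - ∑ l ∈ Finset.range K, (κ l • fderiv ℝ (τ l) (frozenSum N b τ l x))
              (fderiv ℝ (frozenSum N b τ m) x v) := by
      rw [← Finset.sum_add_distrib, ← Finset.sum_sub_distrib]
      refine Finset.sum_congr rfl fun l _ => ?_
      rw [map_smul, smul_apply, smul_eq_mul, smul_eq_mul]
      by_cases hs : gateSlope N b τ l x = 0
      · rw [hκ0 l hs, hs]; ring
      · rw [hτ.fderiv_radiusRatio_apply hN hC, hτ.fderiv_frozenSum_eq hb hN hC (hslope l hs) hm2]
        simp only [hκ]
        ring
    rw [e]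
    ring
  -- For j < m gate j is shut, which cancels the weighted term, and tails starting at m or later
  -- ignore the j-th basis vector.
  have hβ0 : ∀ v, β (fderiv ℝ (frozenSum N b τ m) x v) = 0 := by
    refine hτ.comp_fderiv_frozenSum_eq_zero hb hN hC hmin fun j hjm => ?_
    have h1 := rel (b j)
    rw [Finset.sum_eq_zero (f := fun l => κ l * (radiusRatio N b τ l x *
      fderiv ℝ (tailSize N b l) x (b j))), sub_zero, Finset.sum_eq_single j,
      gate_eq_zero (by linarith [hmin j hjm]), weightedMap_basis hb hN hδ.le hw, map_smul,
      smul_eq_mul, b.coord_self] at h1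
    · linarith
    · intro l _ hl
      rw [b.coord_of_ne hl]; ring
    · intro hj
      exact absurd (Finset.mem_range.2 (hjm.trans_le hmK)) hj
    · intro l _
      by_cases hs : gateSlope N b τ l x = 0
      · rw [hκ0 l hs, zero_mul]
      · rw [fderiv_tailSize_basis_of_lt hN hC (hjm.trans_le (hslope l hs))]; ring
  have rel' : ∀ j, K ≤ j → coordWeight N b δ j * φ (w j) =
      ∑ l ∈ Finset.range K, κ l * (radiusRatio N b τ l x * fderiv ℝ (tailSize N b l) x (b j)) := by
    intro j hj
    have h1 := rel (b j)
    rw [hβ0, Finset.sum_eq_zero (f := fun l => (1 - gate N b τ l x) *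
      (coordWeight N b δ l * b.coord l (b j)) * φ (w l)), weightedMap_basis hb hN hδ.le hw,
      map_smul, smul_eq_mul] at h1
    · linarith
    · intro l hl
      rw [b.coord_of_ne (by have := Finset.mem_range.1 hl; omega)]; ring
  -- If no gate contributed, φ would vanish on w i.
  obtain ⟨l, hl, hκl⟩ : ∃ l ∈ Finset.range K, κ l ≠ 0 := by
    by_contra! hall
    have h1 := rel' i hi
    rw [Finset.sum_eq_zero fun l hl => by rw [hall l hl, zero_mul]] at h1
    exact mul_ne_zero (coordWeight_pos hN hδ i).ne' hφ h1
  have hsl : gateSlope N b τ l x ≠ 0 := fun h => hκl (hκ0 l h)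
  have h1 := rel' j hj
  rw [hwj, map_zero, mul_zero, Finset.sum_eq_single l] at h1
  · have h2 : fderiv ℝ (tailSize N b l) x (b j) = 0 := by
      have h8 := (radiusRatio_of_gateSlope_ne_zero hsl).1
      rcases mul_eq_zero.1 h1.symm with h | h
      · exact absurd h hκl
      · exact (mul_eq_zero.1 h).resolve_left (by linarith)
    exact coord_eq_zero_of_fderiv_tailSize_eq_zero hb hN hC hS
      (by have := Finset.mem_range.1 hl; omega) h2
  · intro k _ hkl
    by_cases hs : gateSlope N b τ k x = 0
    · rw [hκ0 k hs, zero_mul]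
    · exact absurd (hτ.eq_of_gateSlope_ne_zero hb hs hsl) hkl
  · intro h; exact absurd hl h

end Critical

/-! ### A radius family from a countable cover -/

section Covering

theorem SchauderBasis.separableSpace {E : Type*} [NormedAddCommGroup E] [NormedSpace ℝ E]
    (b : SchauderBasis ℝ E) : TopologicalSpace.SeparableSpace E := by
  have h := ((countable_range b).isSeparable.span (R := ℝ)).closure
  rw [← TopologicalSpace.isSeparable_univ_iff]
  refine h.mono fun x _ => ?_
  refine mem_closure_of_tendsto (SchauderBasis.tendsto_proj b x) (Eventually.of_forall fun n => ?_)
  rw [SchauderBasis.proj_apply]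
  exact Submodule.sum_mem _ fun j _ =>
    Submodule.smul_mem _ _ (Submodule.subset_span (mem_range_self j))

variable {E : Type*} [NormedAddCommGroup E] [NormedSpace ℝ E] {N : Seminorm ℝ E}
  {b : SchauderBasis ℝ E}

/-- The profile depends on u², so composing it with N stays C¹ at the centre. It is constant for |u|
≥ 1, and |4u| ≤ 4 elsewhere. -/
theorem abs_bump_sub_le {c : ℝ} (hc : ∀ s, |deriv Real.smoothTransition s| ≤ c) (u v : ℝ) :
    |Real.smoothTransition (2 - 2 * v ^ 2) - Real.smoothTransition (2 - 2 * u ^ 2)|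
      ≤ 4 * c * |v - u| := by
  have hc0 : 0 ≤ c := (abs_nonneg _).trans (hc 0)
  have hd : ∀ u : ℝ, HasDerivAt (fun u => Real.smoothTransition (2 - 2 * u ^ 2))
      (deriv Real.smoothTransition (2 - 2 * u ^ 2) * -(2 * (2 * u))) u := fun u => by
    have h1 : HasDerivAt (fun u : ℝ => 2 - 2 * u ^ 2) (-(2 * (2 * u))) u := by
      simpa using ((hasDerivAt_pow 2 u).const_mul 2).const_sub 2
    exact (Real.smoothTransition.hasDerivAt _).comp u h1
  have := Convex.norm_image_sub_le_of_norm_hasDerivWithin_le (s := univ) (C := 4 * c)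
    (fun u _ => (hd u).hasDerivWithinAt) (fun u _ => ?_) convex_univ (mem_univ u) (mem_univ v)
  · simpa using this
  rw [norm_mul, Real.norm_eq_abs, Real.norm_eq_abs]
  rcases le_or_gt |u| 1 with h | h
  · have h1 : |-(2 * (2 * u))| ≤ 4 := by
      rw [abs_neg, abs_mul, abs_mul, abs_two]; linarith
    calc _ ≤ c * 4 := mul_le_mul (hc _) h1 (abs_nonneg _) hc0
      _ = _ := by ring
  · have h1 : 1 ≤ u ^ 2 := by
      rw [← sq_abs]; nlinarith
    rw [Real.smoothTransition.deriv_eq_zero_of_nonpos (by linarith), abs_zero, zero_mul]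
    positivity

/-- Weighted sums of bump functions supported in the `N`-balls of centre `z i` and
radius `r i`. -/
noncomputable def bumpRadius (N : Seminorm ℝ E) (σ : ℝ) (z : ℕ → E) (r : ℕ → ℝ) (k : ℕ)
    (y : E) : ℝ :=
  ∑ i ∈ Finset.range k, σ * (1 / 2) ^ (i + 1) * r i *
    Real.smoothTransition (2 - 2 * (N (y - z i) / r i) ^ 2)

theorem sum_range_half_pow_le (k : ℕ) : ∑ i ∈ Finset.range k, (1 / 2 : ℝ) ^ (i + 1) ≤ 1 := by
  have h : ∑ i ∈ Finset.range k, (1 / 2 : ℝ) ^ i ≤ 2 := sum_geometric_two_le k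
  simp_rw [pow_succ]
  rw [← Finset.sum_mul]
  linarith

variable {σ : ℝ} {z : ℕ → E} {r : ℕ → ℝ}

/-- The weight r i cancels the 1/r i in the Lipschitz constant of its bump, and the factors
2^(-(i+1)) sum to at most 1. Each index k uses finitely many bumps, so no local finiteness of the
cover is needed. -/
theorem isRadiusFamily_bumpRadius (hN : IsEquivalentNorm N) (hC : IsC1Norm N) (hσ : 0 < σ)
    (hr : ∀ i, 0 < r i) {c : ℝ} (hc : ∀ s, |deriv Real.smoothTransition s| ≤ c) :
    IsRadiusFamily N (4 * c * σ) (bumpRadius N σ z r) := by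
  have hnn : ∀ i y, 0 ≤ σ * (1 / 2) ^ (i + 1) * r i *
      Real.smoothTransition (2 - 2 * (N (y - z i) / r i) ^ 2) := fun i y =>
    mul_nonneg (mul_nonneg (by positivity) (hr i).le) (Real.smoothTransition.nonneg _)
  have hc0 : 0 ≤ c := (abs_nonneg _).trans (hc 0)
  refine ⟨fun k => ?_, fun k y => Finset.sum_nonneg fun i _ => hnn i y, fun y => ?_,
    fun k y w => ?_⟩
  · refine ContDiff.sum fun i _ => contDiff_const.mul ?_
    refine Real.smoothTransition.contDiff.comp (contDiff_const.sub (contDiff_const.mul ?_))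
    simp_rw [div_pow]
    exact ((hC.contDiff_sq hN).comp (contDiff_id.sub contDiff_const)).div_const _
  · refine monotone_nat_of_le_succ fun k => ?_
    simp only [bumpRadius, Finset.sum_range_succ]
    exact le_add_of_nonneg_right (hnn k y)
  · have key : ∀ i, σ * (1 / 2) ^ (i + 1) * r i *
        Real.smoothTransition (2 - 2 * (N (y + w - z i) / r i) ^ 2) ≤
        σ * (1 / 2) ^ (i + 1) * r i * Real.smoothTransition (2 - 2 * (N (y - z i) / r i) ^ 2)
          + (1 / 2) ^ (i + 1) * (4 * c * σ * N w) := by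
      intro i
      have h1 := (le_abs_self _).trans (abs_bump_sub_le hc (N (y - z i) / r i)
        (N (y + w - z i) / r i))
      have h2 : |N (y + w - z i) / r i - N (y - z i) / r i| ≤ N w / r i := by
        rw [← sub_div, abs_div, abs_of_pos (hr i)]
        refine div_le_div_of_nonneg_right ?_ (hr i).le
        refine (abs_sub_map_le_sub N _ _).trans_eq ?_
        congr 1; abel
      have h3 : 4 * c * |N (y + w - z i) / r i - N (y - z i) / r i| ≤ 4 * c * (N w / r i) :=
        mul_le_mul_of_nonneg_left h2 (by positivity)
      have hri := hr i
      have h4 := mul_le_mul_of_nonneg_left (h1.trans h3)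
        (by positivity : 0 ≤ σ * (1 / 2) ^ (i + 1) * r i)
      have e : σ * (1 / 2) ^ (i + 1) * r i * (4 * c * (N w / r i))
          = (1 / 2) ^ (i + 1) * (4 * c * σ * N w) := by
        field_simp
      rw [e] at h4
      linarith
    refine (Finset.sum_le_sum fun i _ => key i).trans ?_
    rw [Finset.sum_add_distrib, ← Finset.sum_mul]
    refine add_le_add le_rfl ?_
    have := apply_nonneg N w
    exact (mul_le_mul_of_nonneg_right (sum_range_half_pow_le k) (by positivity)).trans_eq
      (one_mul _)

/-- Of the balls with index below k that contain y, the one with largest radius dominates the whole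
sum. -/
theorem exists_bumpRadius_le (hσ : 0 < σ) (hr : ∀ i, 0 < r i) {k : ℕ} {y : E}
    (h : 0 < bumpRadius N σ z r k y) :
    ∃ i, N (y - z i) < r i ∧ bumpRadius N σ z r k y ≤ σ * r i := by
  classical
  set T := (Finset.range k).filter fun i => N (y - z i) < r i with hT
  have hzero : ∀ i, ¬ N (y - z i) < r i →
      Real.smoothTransition (2 - 2 * (N (y - z i) / r i) ^ 2) = 0 := by
    intro i hi
    refine Real.smoothTransition.zero_of_nonpos ?_
    have h1 : 1 ≤ N (y - z i) / r i := (one_le_div (hr i)).2 (not_lt.1 hi)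
    nlinarith
  have e : bumpRadius N σ z r k y = ∑ i ∈ T, σ * (1 / 2) ^ (i + 1) * r i *
      Real.smoothTransition (2 - 2 * (N (y - z i) / r i) ^ 2) := by
    refine (Finset.sum_filter_of_ne fun i _ hne => ?_).symm
    by_contra hi
    exact hne (by rw [hzero i hi, mul_zero])
  have hne : T.Nonempty := by
    by_contra hT0
    rw [e, Finset.not_nonempty_iff_eq_empty.1 hT0, Finset.sum_empty] at h
    exact lt_irrefl _ h
  obtain ⟨i, hi, hmax⟩ := T.exists_max_image r hne
  refine ⟨i, (Finset.mem_filter.1 hi).2, ?_⟩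
  have hri := hr i
  rw [e]
  calc _ ≤ ∑ l ∈ T, (1 / 2) ^ (l + 1) * (σ * r i) := by
        refine Finset.sum_le_sum fun l hl => ?_
        have hrl := hr l
        have h1 := hmax l hl
        calc _ ≤ σ * (1 / 2) ^ (l + 1) * r l * 1 :=
              mul_le_mul_of_nonneg_left (Real.smoothTransition.le_one _) (by positivity)
          _ ≤ σ * (1 / 2) ^ (l + 1) * r i * 1 := by gcongr
          _ = _ := by ring
    _ ≤ ∑ l ∈ Finset.range k, (1 / 2) ^ (l + 1) * (σ * r i) :=
        Finset.sum_le_sum_of_subset_of_nonneg (Finset.filter_subset _ _)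
          fun l _ _ => by positivity
    _ ≤ σ * r i := by
        rw [← Finset.sum_mul]
        exact (mul_le_mul_of_nonneg_right (sum_range_half_pow_le k) (by positivity)).trans_eq
          (one_mul _)

theorem eventually_le_bumpRadius (hN : IsEquivalentNorm N) (hσ : 0 < σ) (hr : ∀ i, 0 < r i)
    {i : ℕ} {x : E} (hx : N (x - z i) < r i / 2) :
    ∀ᶠ y in 𝓝 x, ∀ k ≥ i + 1, σ * (1 / 2) ^ (i + 1) * r i ≤ bumpRadius N σ z r k y := by
  have hcont : Continuous fun y => N (y - z i) :=
    hN.continuous.comp (continuous_id.sub continuous_const)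
  filter_upwards [hcont.continuousAt.eventually (gt_mem_nhds hx)] with y hy k hk
  have h1 : N (y - z i) / r i ≤ 1 / 2 := by
    rw [div_le_iff₀ (hr i)]; linarith
  have h2 : (N (y - z i) / r i) ^ 2 ≤ (1 / 2) ^ 2 :=
    pow_le_pow_left₀ (div_nonneg (apply_nonneg N _) (hr i).le) h1 2
  have h3 : Real.smoothTransition (2 - 2 * (N (y - z i) / r i) ^ 2) = 1 :=
    Real.smoothTransition.one_of_one_le (by linarith)
  have h4 := Finset.single_le_sum (f := fun i => σ * (1 / 2) ^ (i + 1) * r i *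
    Real.smoothTransition (2 - 2 * (N (y - z i) / r i) ^ 2)) (s := Finset.range k)
    (fun l _ => mul_nonneg (mul_nonneg (by positivity) (hr l).le)
      (Real.smoothTransition.nonneg _)) (Finset.mem_range.2 hk)
  simp only [h3, mul_one] at h4
  exact h4

/-- A countable cover of an open set by `N`-balls on which a given property holds. -/
theorem exists_countable_cover (hN : IsEquivalentNorm N) (b : SchauderBasis ℝ E) {U : Set E}
    (hne : U.Nonempty) {P : E → ℝ → Prop} (hP : ∀ z ∈ U, ∃ r, 0 < r ∧ P z r) :
    ∃ (z : ℕ → E) (r : ℕ → ℝ), (∀ i, 0 < r i) ∧ (∀ i, P (z i) (r i)) ∧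
      ∀ x ∈ U, ∃ i, N (x - z i) < r i / 2 := by
  have := b.separableSpace
  have := UniformSpace.secondCountable_of_separable E
  choose! r hr0 hr using hP
  obtain ⟨t, htU, htc, hcov⟩ := TopologicalSpace.countable_cover_nhdsWithin (s := U)
    (f := fun z => {x | N (x - z) < r z / 2}) fun z hz => mem_nhdsWithin_of_mem_nhds (by
      have hcont : Continuous fun y => N (y - z) :=
        hN.continuous.comp (continuous_id.sub continuous_const)
      refine hcont.continuousAt.eventually (gt_mem_nhds ?_)
      simp only [sub_self, map_zero]
      exact half_pos (hr0 z hz))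
  have htne : t.Nonempty := by
    obtain ⟨x, hx⟩ := hne
    obtain ⟨z, hz, _⟩ := mem_iUnion₂.1 (hcov hx)
    exact ⟨z, hz⟩
  obtain ⟨z, rfl⟩ := htc.exists_eq_range htne
  refine ⟨z, fun i => r (z i), fun i => hr0 _ (htU (mem_range_self i)),
    fun i => hr _ (htU (mem_range_self i)), fun x hx => ?_⟩
  obtain ⟨_, ⟨i, rfl⟩, h⟩ := mem_iUnion₂.1 (hcov hx)
  exact ⟨i, h⟩

theorem IsOneSuppressionUnconditional.exists_good_radius [CompleteSpace E]
    (hb : IsOneSuppressionUnconditional N b) (hN : IsEquivalentNorm N) (hC : IsC1Norm N)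
    {d : ℕ} {U : Set E} (hU : IsOpen U) {f : E → EuclideanSpace ℝ (Fin d)}
    (hf : ContDiffOn ℝ 1 f U) {ε : E → ℝ} (hε : ContinuousOn ε U) {z : E} (hz : z ∈ U)
    (hεz : 0 < ε z) {η : ℝ} (hη : 0 < η) :
    ∃ r, 0 < r ∧ ∃ e, r ≤ e ∧
      (∀ x, N (x - z) < 2 * r → x ∈ U ∧ e ≤ ε x ∧ ‖f x - f z‖ ≤ η * e ∧
        ‖fderiv ℝ f x - fderiv ℝ f z‖ ≤ η * e) ∧
      ∀ k : ℕ, (1 / 2 : ℝ) ^ k ≤ r → ‖(fderiv ℝ f z).comp (b.tail k)‖ ≤ η * e := by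
  obtain ⟨c, C, hc, hC0, h⟩ := id hN
  set e := ε z / 2 with he
  have he0 : 0 < e := half_pos hεz
  have hηe : 0 < η * e := mul_pos hη he0
  have hUz := hU.mem_nhds hz
  have h1 : ∀ᶠ x in 𝓝 z, e < ε x :=
    (hε.continuousAt hUz).eventually (lt_mem_nhds (half_lt_self hεz))
  have h2 : ∀ᶠ x in 𝓝 z, ‖f x - f z‖ < η * e := by
    simpa [dist_eq_norm] using
      Metric.tendsto_nhds.1 (hf.continuousOn.continuousAt hUz) (η * e) hηe
  have h3 : ∀ᶠ x in 𝓝 z, ‖fderiv ℝ f x - fderiv ℝ f z‖ < η * e := by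
    simpa [dist_eq_norm] using
      Metric.tendsto_nhds.1 ((hf.contDiffAt hUz).continuousAt_fderiv one_ne_zero) (η * e) hηe
  obtain ⟨ρ, hρ, hball⟩ := Metric.eventually_nhds_iff.1
    ((eventually_mem_set.2 hUz).and (h1.and (h2.and h3)))
  have h4 := (hb.tendsto_norm_comp_tail_euclidean hN hC (fderiv ℝ f z)).eventually
    (gt_mem_nhds hηe)
  obtain ⟨k₀, hk₀⟩ := eventually_atTop.1 h4
  -- The bound by half of c ρ keeps the doubled N-ball inside the good neighbourhood; the power of
  -- 1/2 forces k > k₀ whenever (1/2)^k ≤ r.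
  refine ⟨min (min e (c * ρ / 2)) ((1 / 2) ^ (k₀ + 1)), by positivity, e,
    (min_le_left _ _).trans (min_le_left _ _), fun x hx => ?_, fun k hk => ?_⟩
  · have h5 : N (x - z) < c * ρ := by
      have := (min_le_left (min e (c * ρ / 2)) ((1 / 2) ^ (k₀ + 1))).trans (min_le_right _ _)
      linarith
    have h6 : dist x z < ρ := by
      rw [dist_eq_norm]
      exact lt_of_mul_lt_mul_left ((h _).1.trans_lt h5) hc.le
    obtain ⟨h7, h8, h9, h10⟩ := hball h6
    exact ⟨h7, h8.le, h9.le, h10.le⟩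
  · refine (hk₀ k ?_).le
    have h5 := hk.trans (min_le_right _ _)
    have := (pow_le_pow_iff_right_of_lt_one₀ (by norm_num : (0 : ℝ) < 1 / 2) (by norm_num)).1 h5
    omega

end Covering

/-! ### The glued approximation, its error and its critical points -/

section Approximation

variable {E : Type*} [NormedAddCommGroup E] [NormedSpace ℝ E] {N : Seminorm ℝ E}
  {b : SchauderBasis ℝ E} {L : ℝ} {τ : ℕ → E → ℝ} {d : ℕ}
  {w : ℕ → EuclideanSpace ℝ (Fin d)} {δ : ℝ}

/-- A sequence that repeats the vectors of the standard basis and the zero vector periodically. -/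
theorem exists_recurrent_sequence (d : ℕ) : ∃ w : ℕ → EuclideanSpace ℝ (Fin d),
    (∀ j, ‖w j‖ ≤ 1) ∧ (∀ K, {j | K ≤ j ∧ w j = 0}.Infinite) ∧
    ∀ K, ∀ φ : EuclideanSpace ℝ (Fin d) →L[ℝ] ℝ, φ ≠ 0 → ∃ j ≥ K, φ (w j) ≠ 0 := by
  -- Indices are read modulo d + 1, and the residue d gives the zero vector.
  refine ⟨fun j => if h : j % (d + 1) < d then EuclideanSpace.single ⟨j % (d + 1), h⟩ 1 else 0,
    fun j => ?_, fun K => ?_, fun K φ hφ => ?_⟩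
  · dsimp only
    split_ifs <;> simp
  · refine Set.infinite_of_forall_exists_gt fun n => ⟨(n + K + 1) * (d + 1) + d, ⟨?_, ?_⟩, ?_⟩
    · nlinarith
    · dsimp only
      rw [dif_neg]
      rw [Nat.mul_add_mod', Nat.mod_eq_of_lt d.lt_succ_self]
      exact lt_irrefl d
    · nlinarith
  · by_contra! h
    refine hφ ?_
    have h1 : ∀ i, φ (EuclideanSpace.single i 1) = 0 := by
      intro i
      have h2 := h (K * (d + 1) + i) (by nlinarith [i.2])
      have h3 : (K * (d + 1) + i) % (d + 1) = i := by
        rw [Nat.mul_add_mod', Nat.mod_eq_of_lt (i.2.trans d.lt_succ_self)]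
      simp only [h3, i.2, dif_pos] at h2
      exact h2
    have h4 : (φ : EuclideanSpace ℝ (Fin d) →ₗ[ℝ] ℝ) = 0 :=
      (EuclideanSpace.basisFun (Fin d) ℝ).toBasis.ext fun i => by simpa using h1 i
    ext v
    exact LinearMap.congr_fun h4 v

/-- The map `f` precomposed with the `K`-th frozen sum, perturbed by the gated map. -/
noncomputable def approxMap (N : Seminorm ℝ E) (b : SchauderBasis ℝ E) (τ : ℕ → E → ℝ) (δ : ℝ)
    (w : ℕ → EuclideanSpace ℝ (Fin d)) (f : E → EuclideanSpace ℝ (Fin d)) (K : ℕ) (x : E) :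
    EuclideanSpace ℝ (Fin d) :=
  f (frozenSum N b τ K x) + gatedMap N b τ δ w K x

theorem IsRadiusFamily.approxMap_eq (hτ : IsRadiusFamily N L τ)
    (hb : IsOneSuppressionUnconditional N b) {f : E → EuclideanSpace ℝ (Fin d)} {K K' : ℕ}
    {x : E} (hK : 10 < radiusRatio N b τ K x) (hK' : 10 < radiusRatio N b τ K' x) :
    approxMap N b τ δ w f K' x = approxMap N b τ δ w f K x := by
  have key : ∀ {i j : ℕ}, i ≤ j → 10 < radiusRatio N b τ i x →
      approxMap N b τ δ w f j x = approxMap N b τ δ w f i x := by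
    intro i j hij hi
    rw [approxMap, approxMap, hτ.gatedMap_eq hb hij hi, hτ.frozenSum_eq hb hij (by linarith)]
  rcases le_total K K' with h | h
  · exact key h hK
  · exact (key h hK').symm

/-- Local formulas with different K agree wherever both ratios exceed 10: the sums are frozen and
all later gates are fully open. -/
theorem IsRadiusFamily.exists_gluing (hτ : IsRadiusFamily N L τ)
    (hb : IsOneSuppressionUnconditional N b) (hN : IsEquivalentNorm N) (hC : IsC1Norm N)
    (δ : ℝ) (w : ℕ → EuclideanSpace ℝ (Fin d)) (f : E → EuclideanSpace ℝ (Fin d)) :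
    ∃ g : E → EuclideanSpace ℝ (Fin d), ∀ K x, 10 < radiusRatio N b τ K x →
      g =ᶠ[𝓝 x] approxMap N b τ δ w f K := by
  classical
  refine ⟨fun x => if h : ∃ K, 10 < radiusRatio N b τ K x then
    approxMap N b τ δ w f (Nat.find h) x else 0, fun K x hx => ?_⟩
  filter_upwards [(hτ.contDiff_radiusRatio (b := b) hN hC K).continuous.continuousAt.eventually
    (lt_mem_nhds hx)] with y hy
  have h : ∃ K, 10 < radiusRatio N b τ K y := ⟨K, hy⟩
  rw [dif_pos h]
  exact hτ.approxMap_eq hb hy (Nat.find_spec h)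

theorem IsRadiusFamily.contDiffAt_approxMap (hτ : IsRadiusFamily N L τ)
    (hN : IsEquivalentNorm N) (hC : IsC1Norm N) {f : E → EuclideanSpace ℝ (Fin d)} {K : ℕ} {x : E}
    (hf : ContDiffAt ℝ 1 f (frozenSum N b τ K x)) :
    ContDiffAt ℝ 1 (approxMap N b τ δ w f K) x :=
  (hf.comp x (hτ.contDiff_frozenSum hN hC K).contDiffAt).add
    (hτ.contDiff_gatedMap hN hC K).contDiffAt

theorem IsRadiusFamily.fderiv_approxMap_apply (hτ : IsRadiusFamily N L τ)
    (hN : IsEquivalentNorm N) (hC : IsC1Norm N) {f : E → EuclideanSpace ℝ (Fin d)} {K : ℕ} {x : E}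
    (hf : ContDiffAt ℝ 1 f (frozenSum N b τ K x)) (v : E) :
    fderiv ℝ (approxMap N b τ δ w f K) x v =
      fderiv ℝ f (frozenSum N b τ K x) (fderiv ℝ (frozenSum N b τ K) x v)
        + fderiv ℝ (gatedMap N b τ δ w K) x v := by
  have h : HasFDerivAt (approxMap N b τ δ w f K) _ x :=
    ((hf.differentiableAt one_ne_zero).hasFDerivAt.comp x
      (hτ.hasFDerivAt_frozenSum hN hC K x)).add
    ((hτ.contDiff_gatedMap hN hC K).differentiable one_ne_zero x).hasFDerivAt
  rw [h.fderiv]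
  rfl

theorem IsRadiusFamily.mem_coordSubspace_of_critical (hτ : IsRadiusFamily N L τ)
    (hb : IsOneSuppressionUnconditional N b) (hN : IsEquivalentNorm N) (hC : IsC1Norm N)
    (hS : IsStrictlyConvexNorm N) (hδ : 0 < δ) (hw : ∀ j, ‖w j‖ ≤ 1)
    (hspan : ∀ K, ∀ φ : EuclideanSpace ℝ (Fin d) →L[ℝ] ℝ, φ ≠ 0 → ∃ j ≥ K, φ (w j) ≠ 0)
    {f : E → EuclideanSpace ℝ (Fin d)} {K : ℕ} {x : E} (hK : 10 < radiusRatio N b τ K x)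
    (hf : ContDiffAt ℝ 1 f (frozenSum N b τ K x))
    (hx : ¬ Function.Surjective (fderiv ℝ (approxMap N b τ δ w f K) x)) :
    x ∈ coordSubspace b {j | K ≤ j ∧ w j = 0} := by
  set D := fderiv ℝ (approxMap N b τ δ w f K) x with hD
  have hlt : (D : E →ₗ[ℝ] EuclideanSpace ℝ (Fin d)).range < ⊤ := by
    rw [lt_top_iff_ne_top]
    intro h
    exact hx (LinearMap.range_eq_top.1 h)
  obtain ⟨φ, hφ0, hφ⟩ := Submodule.exists_le_ker_of_lt_top _ hlt
  set φ' : EuclideanSpace ℝ (Fin d) →L[ℝ] ℝ := LinearMap.toContinuousLinearMap φ with hφ'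
  have hne : φ' ≠ 0 := by
    intro h
    refine hφ0 (LinearMap.ext fun v => ?_)
    exact DFunLike.congr_fun h v
  obtain ⟨i, hi, hφi⟩ := hspan K φ' hne
  intro j hj
  refine hτ.coord_eq_zero_of_critical (w := w) (φ := φ')
    (α := φ'.comp (fderiv ℝ f (frozenSum N b τ K x))) hb hN hC hS hδ hw hK (fun v => ?_) hi hφi
    hj.1 hj.2
  rw [ContinuousLinearMap.comp_apply, ← map_add, ← hτ.fderiv_approxMap_apply hN hC hf]
  exact hφ ⟨v, rfl⟩

/-- The two error bounds, at a point whose first dominated frozen sum lies in an `N`-ball on which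
`f` is almost affine and almost independent of the tail. -/
theorem IsFirstDominated.approxMap_close {m : ℕ} {x : E}
    (h : IsFirstDominated N b τ m x) (hτ : IsRadiusFamily N L τ)
    (hb : IsOneSuppressionUnconditional N b) {c₀ C₀ : ℝ} (hc₀ : 0 < c₀) (hC₀ : 0 < C₀)
    (hN₀ : ∀ x, c₀ * ‖x‖ ≤ N x ∧ N x ≤ C₀ * ‖x‖)
    (hC : IsC1Norm N) {c : ℝ} (hc1 : 1 ≤ c)
    (hc : ∀ s, |deriv Real.smoothTransition s| ≤ c) (hL0 : 0 ≤ L) (hL : 16 * c * L ≤ 1)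
    (hδ : 0 ≤ δ) (hw : ∀ j, ‖w j‖ ≤ 1) {K : ℕ} (hK : m ≤ K)
    {f : E → EuclideanSpace ℝ (Fin d)} {z : E} {r e η : ℝ} (hη : 0 ≤ η) (hre : r ≤ e) (hr : 0 < r)
    (hz : N (b.proj m x - z) < r) (hm : τ m (b.proj m x) ≤ r)
    (hfz : ∀ y, N (y - z) < 2 * r → ContDiffAt ℝ 1 f y ∧ ‖f y - f z‖ ≤ η * e ∧
        ‖fderiv ℝ f y - fderiv ℝ f z‖ ≤ η * e)
    (htail : ∀ k : ℕ, (1 / 2 : ℝ) ^ k ≤ r → ‖(fderiv ℝ f z).comp (b.tail k)‖ ≤ η * e) :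
    ‖f x - approxMap N b τ δ w f K x‖ ≤ (2 * η + 2 * δ) * e ∧
    ‖fderiv ℝ f x - fderiv ℝ (approxMap N b τ δ w f K) x‖ ≤
      (2 * (1 + (2 + 32 * c) * (C₀ / c₀)) * η
        + 2 * ((1 + c * (L * (2 + 32 * c) + 10) * 20) * C₀) * δ) * e := by
  have hN : IsEquivalentNorm N := ⟨c₀, C₀, hc₀, hC₀, hN₀⟩
  have he : 0 < e := hr.trans_le hre
  have htm : N (b.tail m x) ≤ r := h.tail_le.trans hm
  -- The term (1/2)^m inside the tail size pays off here: domination forces m to be large relative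
  -- to r.
  have hpow : (1 / 2 : ℝ) ^ m ≤ r := (pow_le_tailSize m x).trans (h.tailSize_le.trans hm)
  have hx : N (x - z) < 2 * r := by
    have : x - z = b.tail m x + (b.proj m x - z) := by rw [b.tail_apply]; abel
    rw [this]
    linarith [map_add_le_add N (b.tail m x) (b.proj m x - z)]
  have hy : N (frozenSum N b τ K x - z) < 2 * r := by
    have h1 := h.frozenSum_sub_le hb hN hK
    have : frozenSum N b τ K x - z
        = (frozenSum N b τ K x - b.proj m x) + (b.proj m x - z) := by abel
    rw [this]
    linarith [map_add_le_add N (frozenSum N b τ K x - b.proj m x) (b.proj m x - z)]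
  obtain ⟨-, hx1, hx2⟩ := hfz x hx
  obtain ⟨hyf, hy1, hy2⟩ := hfz _ hy
  constructor
  · have h1 := h.norm_gatedMap_le hb hN hδ hw hK
    have h2 := mul_le_mul_of_nonneg_left (htm.trans hre) hδ
    have e1 : f x - approxMap N b τ δ w f K x
        = (f x - f z) - (f (frozenSum N b τ K x) - f z) - gatedMap N b τ δ w K x := by
      rw [approxMap]; abel
    rw [e1]
    refine (norm_sub_le _ _).trans ((add_le_add (norm_sub_le _ _) le_rfl).trans ?_)
    linarith
  · refine ContinuousLinearMap.opNorm_le_bound _ (by positivity) fun v => ?_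
    set A := fderiv ℝ f z
    set Y := fderiv ℝ (frozenSum N b τ K) x v with hY
    have hYv : ‖Y‖ ≤ (2 + 32 * c) * (C₀ / c₀) * ‖v‖ := by
      have h1 := h.fderiv_frozenSum_le hτ hb hN hC hc1 hc hL0 hL K v
      have h2 := mul_le_mul_of_nonneg_left (hN₀ v).2 (by positivity : 0 ≤ 2 + 32 * c)
      have h3 : ‖Y‖ ≤ ((2 + 32 * c) * (C₀ * ‖v‖)) / c₀ := by
        rw [le_div_iff₀ hc₀, mul_comm]
        exact (hN₀ Y).1.trans (h1.trans h2)
      exact h3.trans_eq (by ring)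
    have h1 : ‖(fderiv ℝ f x - A) v‖ ≤ η * e * ‖v‖ :=
      ContinuousLinearMap.le_of_opNorm_le _ hx2 v
    have h2 : ‖(fderiv ℝ f (frozenSum N b τ K x) - A) Y‖
        ≤ η * e * ((2 + 32 * c) * (C₀ / c₀) * ‖v‖) :=
      (ContinuousLinearMap.le_of_opNorm_le _ hy2 Y).trans
        (mul_le_mul_of_nonneg_left hYv (by positivity))
    -- Y - v lies in the m-th tail, so only the restriction of A to that tail matters.
    have h3 : ‖A (Y - v)‖ ≤ η * e * ((2 + 32 * c) * (C₀ / c₀) * ‖v‖ + ‖v‖) := by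
      rw [← h.tail_fderiv_frozenSum_sub hτ hN hC hK v]
      exact (ContinuousLinearMap.le_of_opNorm_le (A.comp (b.tail m)) (htail m hpow) (Y - v)).trans
        (mul_le_mul_of_nonneg_left ((norm_sub_le _ _).trans (add_le_add hYv le_rfl))
          (by positivity))
    have h4 : ‖fderiv ℝ (gatedMap N b τ δ w K) x v‖
        ≤ δ * (1 + c * (L * (2 + 32 * c) + 10) * 20) * e * (C₀ * ‖v‖) * 2 := by
      refine (h.norm_fderiv_gatedMap_le hτ hb hN hC hc1 hc hL0 hL hδ hw hK v).trans ?_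
      have := hpow.trans hre
      have := (hN₀ v).2
      gcongr
    have e1 : (fderiv ℝ f x - fderiv ℝ (approxMap N b τ δ w f K) x) v =
        (fderiv ℝ f x - A) v - (fderiv ℝ f (frozenSum N b τ K x) - A) Y - A (Y - v)
          - fderiv ℝ (gatedMap N b τ δ w K) x v := by
      rw [sub_apply, hτ.fderiv_approxMap_apply hN hC hyf, sub_apply, sub_apply, map_sub]
      abel
    rw [e1]
    refine (norm_sub_le _ _).trans ((add_le_add ((norm_sub_le _ _).trans
      (add_le_add (norm_sub_le _ _) le_rfl)) le_rfl).trans ?_)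
    refine (add_le_add (add_le_add (add_le_add h1 h2) h3) h4).trans_eq ?_
    ring

end Approximation

theorem theorem3p2 {E : Type*} [NormedAddCommGroup E] [NormedSpace ℝ E] [CompleteSpace E]
    (hE : ¬ FiniteDimensional ℝ E)
    (N : Seminorm ℝ E) (hN : IsEquivalentNorm N) (hN_C1 : IsC1Norm N)
    (hN_conv : IsStrictlyConvexNorm N)
    (b : SchauderBasis ℝ E) (hb : IsOneSuppressionUnconditional N b)
    (d : ℕ) (U : Set E) (hU : IsOpen U)
    (f : E → EuclideanSpace ℝ (Fin d)) (hf : ContDiffOn ℝ 1 f U)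
    (ε : E → ℝ) (hε : ContinuousOn ε U) (hε_pos : ∀ x ∈ U, 0 < ε x) :
    ∃ g : E → EuclideanSpace ℝ (Fin d), ContDiffOn ℝ 1 g U ∧
      (∀ x ∈ U, ‖f x - g x‖ ≤ ε x) ∧
      (∀ x ∈ U, ‖fderiv ℝ f x - fderiv ℝ g x‖ ≤ ε x) ∧
      LocallyInFiniteUnionOfComplemented (criticalSet g U) := by
  rcases U.eq_empty_or_nonempty with rfl | hne
  · refine ⟨0, by simp, by simp, by simp, fun x hx => absurd hx.1 (notMem_empty x)⟩
  obtain ⟨c₀, C₀, hc₀, hC₀, hN₀⟩ := id hN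
  obtain ⟨c, hc1, hc⟩ := Real.smoothTransition.exists_abs_deriv_le
  obtain ⟨w, hw, hinf, hspan⟩ := exists_recurrent_sequence d
  -- Chosen so that L = 4cσ satisfies 16cL = 1.
  set σ : ℝ := 1 / (64 * c ^ 2) with hσ
  have hc0 : 0 < c := by linarith
  have hσ0 : 0 < σ := by positivity
  have hσ1 : σ ≤ 1 := by
    rw [hσ, div_le_one (by positivity)]; nlinarith
  set L := 4 * c * σ with hL
  have hL0 : 0 ≤ L := by positivity
  have hL1 : 16 * c * L ≤ 1 := by
    rw [hL, hσ]; apply le_of_eq; field_simp; norm_num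
  have hL2 : L ≤ 1 / 2 := by nlinarith
  set a₁ := (2 + 32 * c) * (C₀ / c₀) with ha₁
  have ha₁0 : 0 < a₁ := by positivity
  set a₂ := (1 + c * (L * (2 + 32 * c) + 10) * 20) * C₀ with ha₂
  have ha₂0 : 0 < a₂ := by positivity
  -- With these η and δ both error factors, 2η + 2δ and 2(1 + a₁)η + 2a₂δ, are at most 1.
  set η := 1 / (4 * (1 + a₁)) with hη
  set δ := 1 / (4 * (1 + a₂)) with hδ
  have hη0 : 0 < η := by positivity
  have hδ0 : 0 < δ := by positivity
  have hη1 : 4 * η + 4 * (a₁ * η) = 1 := by rw [hη]; field_simp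
  have hδ1 : 4 * δ + 4 * (a₂ * δ) = 1 := by rw [hδ]; field_simp
  have haη : 0 < a₁ * η := by positivity
  have haδ : 0 < a₂ * δ := by positivity
  obtain ⟨z, r, hr, hgood, hcov⟩ := exists_countable_cover hN b hne fun z hz =>
    hb.exists_good_radius hN hN_C1 hU hf hε hz (hε_pos z hz) hη0
  set τ := bumpRadius N σ z r
  have hτ : IsRadiusFamily N L τ := isRadiusFamily_bumpRadius hN hN_C1 hσ0 hr hc
  obtain ⟨g, hg⟩ := hτ.exists_gluing (b := b) hb hN hN_C1 δ w f
  have hfirst : ∀ x ∈ U, ∃ m, IsFirstDominated N b τ m x := fun x hx => by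
    obtain ⟨i, hi⟩ := hcov x hx
    have := hr i
    exact exists_isFirstDominated hN (by positivity) (eventually_le_bumpRadius hN hσ0 hr hi)
  have hlarge : ∀ x ∈ U, ∃ K, 10 < radiusRatio N b τ K x := fun x hx => by
    obtain ⟨m, hm⟩ := hfirst x hx
    exact hm.exists_lt_radiusRatio hτ hb hN hL2 10
  have main : ∀ x ∈ U, ∀ K, 10 < radiusRatio N b τ K x →
      ContDiffAt ℝ 1 f (frozenSum N b τ K x) ∧
      ‖f x - approxMap N b τ δ w f K x‖ ≤ ε x ∧
      ‖fderiv ℝ f x - fderiv ℝ (approxMap N b τ δ w f K) x‖ ≤ ε x := by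
    intro x hx K hK
    obtain ⟨m, hm⟩ := hfirst x hx
    have hmK : m ≤ K := hm.le_of_le_radiusRatio (by linarith)
    have hpos : 0 < τ m (b.proj m x) := (tailSize_pos m x).trans_le hm.tailSize_le
    obtain ⟨i, hi, hir⟩ := exists_bumpRadius_le hσ0 hr hpos
    obtain ⟨e, hre, hball, htail⟩ := hgood i
    have hri := hr i
    have hir' : τ m (b.proj m x) ≤ r i := hir.trans (mul_le_of_le_one_left hri.le hσ1)
    have hball' : ∀ y, N (y - z i) < 2 * r i → ContDiffAt ℝ 1 f y ∧ ‖f y - f (z i)‖ ≤ η * e ∧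
        ‖fderiv ℝ f y - fderiv ℝ f (z i)‖ ≤ η * e := fun y hy =>
      ⟨hf.contDiffAt (hU.mem_nhds (hball y hy).1), (hball y hy).2.2⟩
    obtain ⟨h1, h2⟩ := hm.approxMap_close (K := K) hτ hb hc₀ hC₀ hN₀ hN_C1 hc1 hc hL0 hL1 hδ0.le hw
      hmK hη0.le hre hri hi hir' hball' htail
    have hxz : N (x - z i) < 2 * r i := by
      have h3 := hm.tail_le.trans hir'
      have : x - z i = b.tail m x + (b.proj m x - z i) := by rw [b.tail_apply]; abel
      rw [this]
      linarith [map_add_le_add N (b.tail m x) (b.proj m x - z i)]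
    have hyz : N (frozenSum N b τ K x - z i) < 2 * r i := by
      have h3 := (hm.frozenSum_sub_le hb hN hmK).trans (hm.tail_le.trans hir')
      have : frozenSum N b τ K x - z i
          = (frozenSum N b τ K x - b.proj m x) + (b.proj m x - z i) := by abel
      rw [this]
      linarith [map_add_le_add N (frozenSum N b τ K x - b.proj m x) (b.proj m x - z i)]
    have heε := (hball x hxz).2.1
    have he0 : 0 ≤ e := hri.le.trans hre
    refine ⟨(hball' _ hyz).1, h1.trans ((mul_le_of_le_one_left he0 ?_).trans heε),
      h2.trans ((mul_le_of_le_one_left he0 ?_).trans heε)⟩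
    · linarith
    · linarith
  refine ⟨g, fun x hx => ?_, fun x hx => ?_, fun x hx => ?_, fun x hx => ?_⟩
  · obtain ⟨K, hK⟩ := hlarge x hx
    exact ((hτ.contDiffAt_approxMap hN hN_C1 (main x hx K hK).1).congr_of_eventuallyEq
      (hg K x hK)).contDiffWithinAt
  · obtain ⟨K, hK⟩ := hlarge x hx
    rw [(hg K x hK).eq_of_nhds]
    exact (main x hx K hK).2.1
  · obtain ⟨K, hK⟩ := hlarge x hx
    rw [(hg K x hK).fderiv_eq]
    exact (main x hx K hK).2.2
  · obtain ⟨K, hK⟩ := hlarge x hx.1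
    -- One index K serves a whole neighbourhood, so a single coordinate subspace suffices there.
    refine ⟨{y | 10 < radiusRatio N b τ K y},
      isOpen_lt continuous_const (hτ.contDiff_radiusRatio hN hN_C1 K).continuous, hK, 1,
      fun _ => coordSubspace b {j | K ≤ j ∧ w j = 0}, fun _ => ?_, ?_⟩
    · have hcc := closedComplemented_coordSubspace (A := {j | K ≤ j ∧ w j = 0}) hb hN
      exact ⟨hcc.isClosed, hcc, not_finiteDimensional_quotient_coordSubspace (hinf K)⟩
    · rintro y ⟨⟨hyU, hy⟩, hyK⟩
      rw [(hg K y hyK).fderiv_eq] at hy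
      exact mem_iUnion.2 ⟨0, hτ.mem_coordSubspace_of_critical hb hN hN_C1 hN_conv hδ0 hw hspan hyK
        (main y hyU K hyK).1 hy⟩
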